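/- Let $A\to M$ be a smooth vector bundle over a smooth manifold, with a Lie algebroid structure $([\cdot,\cdot],\rho)$ and differential $d$ on $\Omega(A)=\Gamma(\bigwedge^\bullet A^*)$. Let $C^\infty(T^*\Pi A)$ be the algebra of functions, polynomial in the fibre coordinates, on the cotangent bundle of the supermanifold $\Pi A$ (whose functions are $\Omega(A)$), with its canonical Poisson bracket, the big bracket $\{\cdot,\cdot\}$. Let $\mu\in C^\infty(T^*\Pi A)$ be the function of bidegree $(1,2)$ with $\{\mu,\mu\}=0$ and $\{\mu,\cdot\}=d$ on $\Omega(A)$. Multivectors, forms and $(1,1)$-tensors are regarded as elements of $C^\infty(T^*\Pi A)$, with $\{\alpha,\pi\}=\pi^\sharp\alpha$, $\{X,\omega\}=\omega^\flat X$, $\{X,N\}=NX$ for $X\in\Gamma(A)$, $\alpha\in\Gamma(A^*)$. For $\tau$ a bivector or a $2$-form put $e^{\tau}P=\sum_{k\ge 0}\frac1{k!}\{\dots\{\{P,\tau\},\tau\},\dots,\tau\}$ ($k$ brackets). Let $\pi\in\Gamma(\bigwedge^2A)$ be a Poisson bivector, $[\pi,\pi]_{SN}=0$, and let $\omega\in\Gamma(\bigwedge^2A^*)$.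 Put $\pi^\sharp(\alpha)=\pi(\alpha,\cdot)$, $\omega^\flat(X)=\omega(X,\cdot)$, $N=\pi^\sharp\circ\omega^\flat$, $\omega_N=\omega(N\cdot,\cdot)$, $\psi=d\omega_N$, $H=-d\omega$. Let $\mu_\pi$ be the function of bidegree $(2,1)$ corresponding to the Lie algebroid structure on $A^*$ with anchor $\rho\circ\pi^\sharp$ and bracket $$[\alpha,\beta]_\pi=\mathcal L_{\pi^\sharp\alpha}\beta-\mathcal L_{\pi^\sharp\beta}\alpha-d(\pi(\alpha,\beta)),$$ that is, $\{\{\mu_\pi,\alpha\},\beta\}=[\alpha,\beta]_\pi$ and $\{\{\mu_\pi,\alpha\},f\}=\rho(\pi^\sharp\alpha)f$. Let $$S=\{\pi+N,\mu+H\}+\psi$$ be the Lie quasi-bialgebroid structure on $(A^*,A)$ induced by $(\pi,N,d\omega_N,-d\omega)$. Then $\mu_\pi$ exists and is unique, $\{\mu_\pi,\mu_\pi\}=0$, and $\{S,S\}=0$. Moreover $S=\mu_\pi+d_N^H+(\psi+i_NH)$, where $d_N^H$ is the unique derivation of degree one of $\Omega(A)$ with $d_N^Hf=d_Nf$ and $d_N^H\alpha=d_N\alpha+i_{\pi^\sharp\alpha}H$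 for $f\in C^\infty(M)$, $\alpha\in\Gamma(A^*)$, with $d_N=i_N d-d\,i_N$. The series below are finite sums, and $$S=e^{-\omega}\bigl(e^{-\pi}\mu-\mu\bigr),\qquad e^{-\pi}\mu-\mu=\mu_\pi,\qquad S=e^{-\omega}(\mu_\pi).$$ -/

import Mathlib

namespace SuperCotangent

section Super
variable {Ω : Type*} [Ring Ω] [Algebra ℝ Ω] (σ : Ω →ₐ[ℝ] Ω)

/-- Even part of `f`, where `σ` is the parity involution `f ↦ (-1)^|f| f`. -/
noncomputable def evenPart (f : Ω) : Ω := (2⁻¹ : ℝ) • (f + σ f)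

/-- Odd part of `f`. -/
noncomputable def oddPart (f : Ω) : Ω := (2⁻¹ : ℝ) • (f - σ f)

/-- Contraction in the first argument; for a function `P` on the cotangent space this is `{P, f}`. -/
def contr (P : List Ω → Ω) (f : Ω) : List Ω → Ω := fun l => P (f :: l)

/-- The parity involution `P ↦ (-1)^|P| P` on families of maps. -/
def parity (P : List Ω → Ω) : List Ω → Ω := fun l => σ (P (l.map σ))

/-- The canonical (even) Poisson bracket in terms of families of maps: it is determined by
`{P, Q}|₀ = {P₁, Q₀} + {P₀, Q₁}` on the zero section (empty list), where
`{P₀, Q₁} = -(-1)^(|P| |Q|) Q₁(P₀)`, and by the graded Jacobi identity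
`{{P, Q}, f} = {P, {Q, f}} + (-1)^(|Q| |f|) {{P, f}, Q}`. -/
noncomputable def rawBracket : (List Ω → Ω) → (List Ω → Ω) → List Ω → Ω
  | P, Q, [] => P [Q []] - (Q [evenPart σ (P [])] + parity σ Q [oddPart σ (P [])])
  | P, Q, f :: l =>
      rawBracket P (contr Q f) l + rawBracket (contr P (evenPart σ f)) Q l
        + rawBracket (contr P (oddPart σ f)) (parity σ Q) l

/-- Let `Ω` be the superalgebra of functions on a supermanifold `X`. A function `P` on `T^*X` that is
polynomial in the fibre coordinates (momenta) of `T^*X → X` is the same as a finite family of graded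
symmetric multiderivations of `Ω`: the list `[f₁, …, fₖ]` is sent to the restriction of
`{…{{P, f₁}, f₂}, …, fₖ}` to the zero section, and only the part of `P` of degree `k` in the momenta
contributes to it. The conditions are: multilinearity, graded symmetry, the graded Leibniz
rule `{Y, f g} = {Y, f} g + (-1)^(|Y| |f|) f {Y, g}`, and polynomiality. -/
structure IsFunction (P : List Ω → Ω) : Prop where
  map_add : ∀ (l l' : List Ω) (f g : Ω),
    P (l ++ (f + g) :: l') = P (l ++ f :: l') + P (l ++ g :: l')
  map_smul : ∀ (l l' : List Ω) (c : ℝ) (f : Ω), P (l ++ (c • f) :: l') = c • P (l ++ f :: l')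
  symm_even : ∀ (l l' : List Ω) (f g : Ω), σ f = f →
    P (l ++ f :: g :: l') = P (l ++ g :: f :: l')
  symm_odd : ∀ (l l' : List Ω) (f g : Ω), σ f = -f → σ g = -g →
    P (l ++ f :: g :: l') = -P (l ++ g :: f :: l')
  leibniz : ∀ (l : List Ω) (f g : Ω),
    P (l ++ [f * g]) = P (l ++ [f]) * g + evenPart σ f * P (l ++ [g])
      + oddPart σ f * σ (P (l ++ [σ g]))
  polynomial : ∃ n : ℕ, ∀ l : List Ω, n ≤ l.length → P l = 0

variable {σ}

theorem IsFunction.contr {P : List Ω → Ω} (hP : IsFunction σ P) (f : Ω) :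
    IsFunction σ (contr P f) where
  map_add l l' := hP.map_add (f :: l) l'
  map_smul l l' := hP.map_smul (f :: l) l'
  symm_even l l' := hP.symm_even (f :: l) l'
  symm_odd l l' := hP.symm_odd (f :: l) l'
  leibniz l := hP.leibniz (f :: l)
  polynomial := by
    obtain ⟨n, hn⟩ := hP.polynomial
    exact ⟨n, fun l hl => hn _ (by simp; omega)⟩

theorem IsFunction.parity {P : List Ω → Ω} (hP : IsFunction σ P) (hσ : ∀ f, σ (σ f) = f) :
    IsFunction σ (parity σ P) where
  map_add l l' f g := by simp [SuperCotangent.parity, hP.map_add]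
  map_smul l l' c f := by simp [SuperCotangent.parity, hP.map_smul]
  symm_even l l' f g h := by
    simp only [SuperCotangent.parity, List.map_append, List.map_cons]
    rw [hP.symm_even _ _ _ _ (by rw [hσ, h])]
  symm_odd l l' f g hf hg := by
    simp only [SuperCotangent.parity, List.map_append, List.map_cons]
    rw [hP.symm_odd _ _ _ _ (by rw [hσ, hf, neg_neg]) (by rw [hσ, hg, neg_neg]), _root_.map_neg]
  leibniz l f g := by
    simp only [SuperCotangent.parity, List.map_append, List.map_cons, List.map_nil, _root_.map_mul]
    rw [hP.leibniz]
    simp [evenPart, oddPart, hσ, add_comm]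
  polynomial := by
    obtain ⟨n, hn⟩ := hP.polynomial
    exact ⟨n, fun l hl => by simp [SuperCotangent.parity, hn (l.map σ) (by simpa using hl)]⟩

theorem IsFunction.zero : IsFunction σ (0 : List Ω → Ω) where
  map_add _ _ _ _ := by simp
  map_smul _ _ _ _ := by simp
  symm_even _ _ _ _ _ := rfl
  symm_odd _ _ _ _ _ _ := by simp
  leibniz _ _ _ := by simp
  polynomial := ⟨0, fun _ _ => rfl⟩

theorem IsFunction.add {P Q : List Ω → Ω} (hP : IsFunction σ P) (hQ : IsFunction σ Q) :
    IsFunction σ (P + Q) where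
  map_add l l' f g := by simp only [Pi.add_apply, hP.map_add, hQ.map_add]; abel
  map_smul l l' c f := by simp only [Pi.add_apply, hP.map_smul, hQ.map_smul, smul_add]
  symm_even l l' f g h := by
    simp only [Pi.add_apply, hP.symm_even l l' f g h, hQ.symm_even l l' f g h]
  symm_odd l l' f g h h' := by
    simp only [Pi.add_apply, hP.symm_odd l l' f g h h', hQ.symm_odd l l' f g h h', neg_add]
  leibniz l f g := by
    simp only [Pi.add_apply, hP.leibniz, hQ.leibniz, _root_.map_add, mul_add, add_mul]; abel
  polynomial := by
    obtain ⟨m, hm⟩ := hP.polynomial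
    obtain ⟨n, hn⟩ := hQ.polynomial
    exact ⟨m + n, fun l hl => by
      rw [Pi.add_apply, hm l (by omega), hn l (by omega), add_zero]⟩

theorem IsFunction.smul (c : ℝ) {P : List Ω → Ω} (hP : IsFunction σ P) :
    IsFunction σ (c • P) where
  map_add l l' f g := by simp only [Pi.smul_apply, hP.map_add, smul_add]
  map_smul l l' a f := by simp only [Pi.smul_apply, hP.map_smul, smul_comm c a]
  symm_even l l' f g h := by simp only [Pi.smul_apply, hP.symm_even l l' f g h]
  symm_odd l l' f g h h' := by simp only [Pi.smul_apply, hP.symm_odd l l' f g h h', smul_neg]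
  leibniz l f g := by
    simp only [Pi.smul_apply, hP.leibniz, _root_.map_smul, smul_add, smul_mul_assoc,
      mul_smul_comm]
  polynomial := by
    obtain ⟨n, hn⟩ := hP.polynomial
    exact ⟨n, fun l hl => by rw [Pi.smul_apply, hn l hl, smul_zero]⟩

theorem IsFunction.contr_add {P : List Ω → Ω} (hP : IsFunction σ P) (f g : Ω) :
    SuperCotangent.contr P (f + g) = SuperCotangent.contr P f + SuperCotangent.contr P g :=
  funext fun l => hP.map_add [] l f g

theorem IsFunction.contr_smul {P : List Ω → Ω} (hP : IsFunction σ P) (c : ℝ) (f : Ω) :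
    SuperCotangent.contr P (c • f) = c • SuperCotangent.contr P f :=
  funext fun l => hP.map_smul [] l c f

theorem IsFunction.contr_zero {P : List Ω → Ω} (hP : IsFunction σ P) :
    SuperCotangent.contr P 0 = 0 := by
  simpa using hP.contr_smul 0 0

theorem IsFunction.contr_neg {P : List Ω → Ω} (hP : IsFunction σ P) (f : Ω) :
    SuperCotangent.contr P (-f) = -SuperCotangent.contr P f := by
  simpa using hP.contr_smul (-1) f

theorem contr_zero_left (f : Ω) : SuperCotangent.contr (0 : List Ω → Ω) f = 0 := rfl

theorem evenPart_add (f g : Ω) : evenPart σ (f + g) = evenPart σ f + evenPart σ g := by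
  simp only [evenPart, map_add]; module

theorem oddPart_add (f g : Ω) : oddPart σ (f + g) = oddPart σ f + oddPart σ g := by
  simp only [oddPart, map_add]; module

theorem evenPart_smul (c : ℝ) (f : Ω) : evenPart σ (c • f) = c • evenPart σ f := by
  simp only [evenPart, map_smul]; module

theorem oddPart_smul (c : ℝ) (f : Ω) : oddPart σ (c • f) = c • oddPart σ f := by
  simp only [oddPart, map_smul]; module

theorem evenPart_add_oddPart (f : Ω) : evenPart σ f + oddPart σ f = f := by
  simp only [evenPart, oddPart]; module

theorem apply_evenPart (hσ : ∀ f, σ (σ f) = f) (f : Ω) : σ (evenPart σ f) = evenPart σ f := by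
  simp only [evenPart, map_smul, map_add, hσ, add_comm]

theorem apply_oddPart (hσ : ∀ f, σ (σ f) = f) (f : Ω) : σ (oddPart σ f) = -oddPart σ f := by
  simp only [oddPart, map_smul, map_sub, hσ]; module

theorem evenPart_of_even {f : Ω} (h : σ f = f) : evenPart σ f = f := by
  rw [evenPart, h]; module

theorem oddPart_of_even {f : Ω} (h : σ f = f) : oddPart σ f = 0 := by
  rw [oddPart, h]; module

theorem evenPart_of_odd {f : Ω} (h : σ f = -f) : evenPart σ f = 0 := by
  rw [evenPart, h]; module

theorem oddPart_of_odd {f : Ω} (h : σ f = -f) : oddPart σ f = f := by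
  rw [oddPart, h]; module

theorem parity_add (P Q : List Ω → Ω) : parity σ (P + Q) = parity σ P + parity σ Q := by
  funext l; simp [parity]

theorem parity_smul (c : ℝ) (P : List Ω → Ω) : parity σ (c • P) = c • parity σ P := by
  funext l; simp [parity]

theorem parity_parity (hσ : ∀ f, σ (σ f) = f) (P : List Ω → Ω) :
    parity σ (parity σ P) = P := by
  have : (σ : Ω → Ω) ∘ σ = id := funext hσ
  funext l; simp [parity, hσ, this]

theorem contr_parity (hσ : ∀ f, σ (σ f) = f) (P : List Ω → Ω) (f : Ω) :
    contr (parity σ P) f = parity σ (contr P (σ f)) := by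
  funext l; simp [parity, contr]

theorem rawBracket_add_left (hσ : ∀ f, σ (σ f) = f) (l : List Ω) :
    ∀ {P P' Q : List Ω → Ω}, IsFunction σ Q →
      rawBracket σ (P + P') Q l = rawBracket σ P Q l + rawBracket σ P' Q l := by
  induction l with
  | nil =>
    intro P P' Q hQ
    have h1 := hQ.map_add [] []
    have h2 := (hQ.parity hσ).map_add [] []
    simp only [List.nil_append] at h1 h2
    simp only [rawBracket, Pi.add_apply, evenPart_add, oddPart_add, h1, h2]
    abel
  | cons f l ih =>
    intro P P' Q hQ
    have h : ∀ g, contr (P + P') g = contr P g + contr P' g := fun _ => rfl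
    simp only [rawBracket, h, ih hQ, ih (hQ.contr f), ih (hQ.parity hσ)]
    abel

theorem rawBracket_add_right (l : List Ω) :
    ∀ {P Q Q' : List Ω → Ω}, IsFunction σ P →
      rawBracket σ P (Q + Q') l = rawBracket σ P Q l + rawBracket σ P Q' l := by
  induction l with
  | nil =>
    intro P Q Q' hP
    have h1 := hP.map_add [] []
    simp only [List.nil_append] at h1
    simp only [rawBracket, Pi.add_apply, parity_add, h1]
    abel
  | cons f l ih =>
    intro P Q Q' hP
    have h : contr (Q + Q') f = contr Q f + contr Q' f := rfl
    simp only [rawBracket, h, ih hP, ih (hP.contr _), parity_add]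
    abel

theorem rawBracket_smul_left (hσ : ∀ f, σ (σ f) = f) (c : ℝ) (l : List Ω) :
    ∀ {P Q : List Ω → Ω}, IsFunction σ Q →
      rawBracket σ (c • P) Q l = c • rawBracket σ P Q l := by
  induction l with
  | nil =>
    intro P Q hQ
    have h1 := hQ.map_smul [] []
    have h2 := (hQ.parity hσ).map_smul [] []
    simp only [List.nil_append] at h1 h2
    simp only [rawBracket, Pi.smul_apply, evenPart_smul, oddPart_smul, h1, h2]
    module
  | cons f l ih =>
    intro P Q hQ
    have h : ∀ g, contr (c • P) g = c • contr P g := fun _ => rfl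
    simp only [rawBracket, h, ih hQ, ih (hQ.contr f), ih (hQ.parity hσ)]
    module

theorem rawBracket_smul_right (c : ℝ) (l : List Ω) :
    ∀ {P Q : List Ω → Ω}, IsFunction σ P →
      rawBracket σ P (c • Q) l = c • rawBracket σ P Q l := by
  induction l with
  | nil =>
    intro P Q hP
    have h1 := hP.map_smul [] []
    simp only [List.nil_append] at h1
    simp only [rawBracket, Pi.smul_apply, parity_smul, h1]
    module
  | cons f l ih =>
    intro P Q hP
    have h : contr (c • Q) f = c • contr Q f := rfl
    simp only [rawBracket, h, ih hP, ih (hP.contr _), parity_smul]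
    module

theorem rawBracket_zero_left (hσ : ∀ f, σ (σ f) = f) {Q : List Ω → Ω} (hQ : IsFunction σ Q)
    (l : List Ω) : rawBracket σ 0 Q l = 0 := by
  simpa using rawBracket_smul_left hσ 0 l (P := 0) hQ

theorem rawBracket_neg_right {P Q : List Ω → Ω} (hP : IsFunction σ P)
    (l : List Ω) : rawBracket σ P (-Q) l = -rawBracket σ P Q l := by
  simpa using rawBracket_smul_right (-1) l (Q := Q) hP

theorem rawBracket_neg_left (hσ : ∀ f, σ (σ f) = f) {P Q : List Ω → Ω} (hQ : IsFunction σ Q)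
    (l : List Ω) : rawBracket σ (-P) Q l = -rawBracket σ P Q l := by
  simpa using rawBracket_smul_left hσ (-1) l (P := P) hQ

theorem parity_rawBracket (hσ : ∀ f, σ (σ f) = f) (l : List Ω) :
    ∀ {P Q : List Ω → Ω}, IsFunction σ P → IsFunction σ Q →
      parity σ (rawBracket σ P Q) l = rawBracket σ (parity σ P) (parity σ Q) l := by
  have e1 : ∀ f, evenPart σ (σ f) = evenPart σ f := fun f => by
    simp only [evenPart, hσ, add_comm]
  have e2 : ∀ f, σ (evenPart σ f) = evenPart σ f := apply_evenPart hσ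
  have e3 : ∀ f, oddPart σ (σ f) = -oddPart σ f := fun f => by
    simp only [oddPart, hσ]; module
  have e4 : ∀ f, σ (oddPart σ f) = -oddPart σ f := apply_oddPart hσ
  induction l with
  | nil =>
    intro P Q hP hQ
    simp [parity, rawBracket, e1, e2, e3, e4, hσ]
  | cons f l ih =>
    intro P Q hP hQ
    have ih' : ∀ {P Q : List Ω → Ω}, IsFunction σ P → IsFunction σ Q →
        σ (rawBracket σ P Q (l.map σ)) = rawBracket σ (parity σ P) (parity σ Q) l := ih
    have h2 := contr_parity hσ P (evenPart σ f)
    have h3 := contr_parity hσ P (oddPart σ f)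
    rw [e2] at h2
    rw [e4] at h3
    rw [rawBracket, contr_parity hσ, h2, h3]
    simp only [parity, List.map_cons]
    rw [rawBracket, map_add, map_add, ih' hP (hQ.contr _), ih' (hP.contr _) hQ,
      ih' (hP.contr _) (hQ.parity hσ), e1, e3]

theorem rawBracket_map_add (hσ : ∀ f, σ (σ f) = f) (l l' : List Ω) (f g : Ω) :
    ∀ {P Q : List Ω → Ω}, IsFunction σ P → IsFunction σ Q →
      rawBracket σ P Q (l ++ (f + g) :: l')
        = rawBracket σ P Q (l ++ f :: l') + rawBracket σ P Q (l ++ g :: l') := by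
  induction l with
  | nil =>
    intro P Q hP hQ
    simp only [List.nil_append, rawBracket, evenPart_add, oddPart_add, hP.contr_add, hQ.contr_add,
      rawBracket_add_right l' hP, rawBracket_add_left hσ l' hQ,
      rawBracket_add_left hσ l' (hQ.parity hσ)]
    abel
  | cons a l ih =>
    intro P Q hP hQ
    simp only [List.cons_append, rawBracket, ih hP (hQ.contr _), ih (hP.contr _) hQ,
      ih (hP.contr _) (hQ.parity hσ)]
    abel

theorem rawBracket_map_smul (hσ : ∀ f, σ (σ f) = f) (l l' : List Ω) (c : ℝ) (f : Ω) :
    ∀ {P Q : List Ω → Ω}, IsFunction σ P → IsFunction σ Q →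
      rawBracket σ P Q (l ++ (c • f) :: l') = c • rawBracket σ P Q (l ++ f :: l') := by
  induction l with
  | nil =>
    intro P Q hP hQ
    simp only [List.nil_append, rawBracket, evenPart_smul, oddPart_smul, hP.contr_smul,
      hQ.contr_smul, rawBracket_smul_right c l' hP, rawBracket_smul_left hσ c l' hQ,
      rawBracket_smul_left hσ c l' (hQ.parity hσ)]
    module
  | cons a l ih =>
    intro P Q hP hQ
    simp only [List.cons_append, rawBracket, ih hP (hQ.contr _), ih (hP.contr _) hQ,
      ih (hP.contr _) (hQ.parity hσ)]
    module

theorem rawBracket_symm_even (hσ : ∀ f, σ (σ f) = f) (l l' : List Ω) (f g : Ω) (hf : σ f = f) :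
    ∀ {P Q : List Ω → Ω}, IsFunction σ P → IsFunction σ Q →
      rawBracket σ P Q (l ++ f :: g :: l') = rawBracket σ P Q (l ++ g :: f :: l') := by
  induction l with
  | nil =>
    intro P Q hP hQ
    have hs : ∀ {P : List Ω → Ω}, IsFunction σ P → ∀ g,
        contr (contr P g) f = contr (contr P f) g := fun {P} hP g => by
      funext l
      exact (hP.symm_even [] l f g hf).symm
    have hz : ∀ {P : List Ω → Ω}, IsFunction σ P → contr P 0 = 0 := fun hP => hP.contr_zero
    simp only [List.nil_append, rawBracket, evenPart_of_even hf, oddPart_of_even hf,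
      hz hP, hz (hP.contr _), contr_zero_left, rawBracket_zero_left hσ hQ, contr_parity hσ, hf, hs hP, hs hQ,
      rawBracket_zero_left hσ (hQ.parity hσ), rawBracket_zero_left hσ (hQ.contr _),
      rawBracket_zero_left hσ ((hQ.parity hσ).parity hσ),
      rawBracket_zero_left hσ ((hQ.contr _).parity hσ)]
    abel
  | cons a l ih =>
    intro P Q hP hQ
    simp only [List.cons_append, rawBracket, ih hP (hQ.contr _), ih (hP.contr _) hQ,
      ih (hP.contr _) (hQ.parity hσ)]

theorem rawBracket_symm_odd (hσ : ∀ f, σ (σ f) = f) (l l' : List Ω) (f g : Ω) (hf : σ f = -f)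
    (hg : σ g = -g) :
    ∀ {P Q : List Ω → Ω}, IsFunction σ P → IsFunction σ Q →
      rawBracket σ P Q (l ++ f :: g :: l') = -rawBracket σ P Q (l ++ g :: f :: l') := by
  induction l with
  | nil =>
    intro P Q hP hQ
    have hs : ∀ {P : List Ω → Ω}, IsFunction σ P →
        contr (contr P g) f = -contr (contr P f) g := fun {P} hP => by
      funext l
      exact (hP.symm_odd [] l g f hg hf)
    have hz : ∀ {P : List Ω → Ω}, IsFunction σ P → contr P 0 = 0 := fun hP => hP.contr_zero
    have hn : ∀ P : List Ω → Ω, parity σ (-P) = -parity σ P := fun P => by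
      funext l; simp [parity]
    simp only [List.nil_append, rawBracket, evenPart_of_odd hf, oddPart_of_odd hf,
      evenPart_of_odd hg, oddPart_of_odd hg,
      hz hP, hz (hP.contr _), contr_zero_left, rawBracket_zero_left hσ hQ, contr_parity hσ, hf, hg, hs hP, hs hQ,
      hQ.contr_neg, hn, rawBracket_neg_right hP, rawBracket_neg_right (hP.contr _),
      parity_parity hσ, rawBracket_neg_left hσ hQ,
      rawBracket_zero_left hσ (hQ.parity hσ), rawBracket_zero_left hσ (hQ.contr _)]
    abel
  | cons a l ih =>
    intro P Q hP hQ
    simp only [List.cons_append, rawBracket, ih hP (hQ.contr _), ih (hP.contr _) hQ,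
      ih (hP.contr _) (hQ.parity hσ)]
    abel

theorem rawBracket_polynomial (hσ : ∀ f, σ (σ f) = f) (l : List Ω) :
    ∀ {P Q : List Ω → Ω} (m n : ℕ), IsFunction σ P → IsFunction σ Q →
      (∀ f : List Ω, m ≤ f.length → P f = 0) → (∀ f : List Ω, n ≤ f.length → Q f = 0) →
      m + n ≤ l.length → rawBracket σ P Q l = 0 := by
  induction l with
  | nil =>
    intro P Q m n hP hQ hm hn h
    have h' : m = 0 ∧ n = 0 := by simpa using h
    have hP' : P = 0 := funext fun g => hm g (by omega)
    have hQ' : Q = 0 := funext fun g => hn g (by omega)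
    simp [rawBracket, parity, hP', hQ']
  | cons f l ih =>
    intro P Q m n hP hQ hm hn h
    have hpar : ∀ g : List Ω, n ≤ g.length → parity σ Q g = 0 := fun g hg => by
      simp [parity, hn (g.map σ) (by simpa using hg)]
    rcases m with _ | m
    · have : P = 0 := funext fun g => hm g (Nat.zero_le _)
      rw [this, rawBracket_zero_left hσ hQ]
    rcases n with _ | n
    · have : Q = 0 := funext fun g => hn g (Nat.zero_le _)
      rw [this]
      simpa using rawBracket_smul_right 0 (f :: l) (Q := 0) hP
    have h1 : ∀ a, ∀ g : List Ω, m ≤ g.length → contr P a g = 0 := fun a g hg =>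
      hm _ (by simpa using hg)
    have h2 : ∀ a, ∀ g : List Ω, n ≤ g.length → contr Q a g = 0 := fun a g hg =>
      hn _ (by simpa using hg)
    simp only [List.length_cons] at h
    rw [rawBracket, ih (m + 1) n hP (hQ.contr f) hm (h2 f) (by omega),
      ih m (n + 1) (hP.contr _) hQ (h1 _) hn (by omega),
      ih m (n + 1) (hP.contr _) (hQ.parity hσ) (h1 _) hpar (by omega)]
    simp

theorem koszulSign_aux {s t : ℝ} (hs : s = 1 ∨ s = -1) (ht : t = 1 ∨ t = -1)
    {Q : List Ω → Ω} (hQ : IsFunction σ Q) (hQt : parity σ Q = t • Q) (l : List Ω) {c : Ω}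
    (hc : σ c = s • c) :
    Q (evenPart σ c :: l) + parity σ Q (oddPart σ c :: l)
      = ((2⁻¹ : ℝ) * (1 + s + t - s * t)) • Q (c :: l) := by
  have h0 := congrFun hQ.contr_zero l
  simp only [contr, Pi.zero_apply] at h0
  rw [hQt]
  rcases hs with rfl | rfl <;> rcases ht with rfl | rfl
  all_goals
    first
    | rw [one_smul] at hc
      rw [evenPart_of_even hc, oddPart_of_even hc, Pi.smul_apply, h0]
      norm_num
    | rw [neg_one_smul] at hc
      rw [evenPart_of_odd hc, oddPart_of_odd hc, Pi.smul_apply, h0]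
      norm_num

theorem parity_contr {t : ℝ} (hσ : ∀ f, σ (σ f) = f) {Q : List Ω → Ω} (hQ : IsFunction σ Q)
    (hQt : parity σ Q = t • Q) {u : ℝ} {c : Ω} (hc : σ c = u • c) :
    parity σ (contr Q c) = (t * u) • contr Q c := by
  have := contr_parity hσ Q (σ c)
  rw [hσ, hQt, hc, show contr (t • Q) (u • c) = t • contr Q (u • c) from rfl, hQ.contr_smul] at this
  rw [← this, smul_smul]

theorem rawBracket_leibniz_aux (hσ : ∀ f, σ (σ f) = f) {P Q : List Ω → Ω} {s t u : ℝ}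
    (hs : s = 1 ∨ s = -1) (ht : t = 1 ∨ t = -1) (hu : u = 1 ∨ u = -1)
    (hP : IsFunction σ P) (hQ : IsFunction σ Q) (hPs : parity σ P = s • P)
    (hQt : parity σ Q = t • Q) (f g : Ω) (hf : σ f = u • f) :
    rawBracket σ P Q [f * g] = rawBracket σ P Q [f] * g + evenPart σ f * rawBracket σ P Q [g]
      + oddPart σ f * σ (rawBracket σ P Q [σ g]) := by
  have pm : ∀ {a b : ℝ}, (a = 1 ∨ a = -1) → (b = 1 ∨ b = -1) → (a * b = 1 ∨ a * b = -1) := by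
    rintro a b (rfl | rfl) (rfl | rfl) <;> simp
  have base : ∀ {P Q : List Ω → Ω} {s t : ℝ}, (s = 1 ∨ s = -1) → (t = 1 ∨ t = -1) →
      IsFunction σ Q → parity σ P = s • P → parity σ Q = t • Q →
      rawBracket σ P Q [] = P [Q []] - ((2⁻¹ : ℝ) * (1 + s + t - s * t)) • Q [P []] := by
    intro P Q s t hs ht hQ hPs hQt
    have hc : σ (P []) = s • P [] := congrFun hPs []
    rw [rawBracket, koszulSign_aux hs ht hQ hQt [] hc]
  -- the bracket on one argument, for a homogeneous argument and then in general
  have key0 : ∀ (h : Ω) {u : ℝ}, (u = 1 ∨ u = -1) → σ h = u • h →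
      rawBracket σ P Q [h] = P [Q [h]] + P [Q [], h]
      - ((2⁻¹ : ℝ) * (1 + s + t - s * t)) • (Q [P [h]] + Q [P [], h]) := by
    intro h u hu hh
    have hQ0 : σ (Q []) = t • Q [] := congrFun hQt []
    have hP0 : σ (P []) = s • P [] := congrFun hPs []
    have b1 : rawBracket σ P (contr Q h) [] = P [Q [h]]
        - ((2⁻¹ : ℝ) * (1 + s + t * u - s * (t * u))) • Q [h, P []] :=
      base hs (pm ht hu) (hQ.contr h) hPs (parity_contr hσ hQ hQt hh)
    have b2 : rawBracket σ (contr P h) Q [] = P [h, Q []]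
        - ((2⁻¹ : ℝ) * (1 + s * u + t - s * u * t)) • Q [P [h]] :=
      base (pm hs hu) ht hQ (parity_contr hσ hP hPs hh) hQt
    rw [rawBracket, b1, hQt, rawBracket_smul_right t [] (hP.contr _)]
    have sw : ∀ {R : List Ω → Ω} {w : ℝ}, IsFunction σ R → (w = 1 ∨ w = -1) → ∀ c : Ω,
        σ c = w • c → R [c, h] = ((2⁻¹ : ℝ) * (1 + u + w - u * w)) • R [h, c] := by
      intro R w hR hw c hc
      rcases hu with rfl | rfl
      · rw [one_smul] at hh
        have := hR.symm_even [] [] h c hh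
        simp only [List.nil_append] at this
        rw [this]; norm_num
      · rw [neg_one_smul] at hh
        rcases hw with rfl | rfl
        · rw [one_smul] at hc
          have := hR.symm_even [] [] c h hc
          simp only [List.nil_append] at this
          rw [this]; norm_num
        · rw [neg_one_smul] at hc
          have := hR.symm_odd [] [] c h hc hh
          simp only [List.nil_append] at this
          rw [this]; norm_num
    rw [sw hP ht _ hQ0, sw hQ hs _ hP0]
    have z0 : rawBracket σ (contr P 0) Q [] = 0 := by
      rw [hP.contr_zero, rawBracket_zero_left hσ hQ]
    rcases hu with rfl | rfl
    · rw [one_smul] at hh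
      rw [evenPart_of_even hh, oddPart_of_even hh]
      rw [z0, b2]
      rcases hs with rfl | rfl <;> rcases ht with rfl | rfl <;> norm_num <;> abel
    · rw [neg_one_smul] at hh
      rw [evenPart_of_odd hh, oddPart_of_odd hh]
      rw [z0, b2]
      rcases hs with rfl | rfl <;> rcases ht with rfl | rfl <;> norm_num <;> abel
  have key : ∀ h : Ω, rawBracket σ P Q [h] = P [Q [h]] + P [Q [], h]
      - ((2⁻¹ : ℝ) * (1 + s + t - s * t)) • (Q [P [h]] + Q [P [], h]) := by
    intro h
    have k1 := key0 (evenPart σ h) (Or.inl rfl) (by rw [apply_evenPart hσ, one_smul])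
    have k2 := key0 (oddPart σ h) (Or.inr rfl) (by rw [apply_oddPart hσ, neg_one_smul])
    have a0 := rawBracket_map_add hσ [] [] (evenPart σ h) (oddPart σ h) hP hQ
    have a1 := hP.map_add [] [] (Q [evenPart σ h]) (Q [oddPart σ h])
    have a2 := hQ.map_add [] [] (P [evenPart σ h]) (P [oddPart σ h])
    have a3 := hP.map_add [Q []] [] (evenPart σ h) (oddPart σ h)
    have a4 := hQ.map_add [P []] [] (evenPart σ h) (oddPart σ h)
    have a5 := hP.map_add [] [] (evenPart σ h) (oddPart σ h)
    have a6 := hQ.map_add [] [] (evenPart σ h) (oddPart σ h)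
    simp only [List.nil_append, List.cons_append, evenPart_add_oddPart] at a0 a1 a2 a3 a4 a5 a6
    rw [a0, k1, k2, a3, a4, a5, a6, a1, a2]
    module
  have LX : ∀ {R : List Ω → Ω} {w v : ℝ} (l : List Ω), IsFunction σ R → (w = 1 ∨ w = -1) →
      (v = 1 ∨ v = -1) → (∀ h, σ (R (l ++ [σ h])) = w • R (l ++ [h])) → ∀ c g : Ω, σ c = v • c →
      R (l ++ [c * g]) = R (l ++ [c]) * g
        + ((2⁻¹ : ℝ) * (1 + w + v - w * v)) • (c * R (l ++ [g])) := by
    intro R w v l hR hw hv hh c g hc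
    rw [hR.leibniz, hh]
    rcases hv with rfl | rfl
    · rw [one_smul] at hc
      rw [evenPart_of_even hc, oddPart_of_even hc]
      rcases hw with rfl | rfl <;> norm_num
    · rw [neg_one_smul] at hc
      rw [evenPart_of_odd hc, oddPart_of_odd hc]
      rcases hw with rfl | rfl <;> norm_num
  have P1 : ∀ h, σ (P ([] ++ [σ h])) = s • P ([] ++ [h]) := fun h => congrFun hPs [h]
  have Q1 : ∀ h, σ (Q ([] ++ [σ h])) = t • Q ([] ++ [h]) := fun h => congrFun hQt [h]
  have P2 : ∀ h, σ (P ([Q []] ++ [σ h])) = (s * t) • P ([Q []] ++ [h]) := fun h =>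
    congrFun (parity_contr hσ hP hPs (congrFun hQt [])) [h]
  have Q2 : ∀ h, σ (Q ([P []] ++ [σ h])) = (t * s) • Q ([P []] ++ [h]) := fun h =>
    congrFun (parity_contr hσ hQ hQt (congrFun hPs [])) [h]
  have hPf : σ (P [f]) = (s * u) • P [f] := congrFun (parity_contr hσ hP hPs hf) []
  have hQf : σ (Q [f]) = (t * u) • Q [f] := congrFun (parity_contr hσ hQ hQt hf) []
  have hR : σ (rawBracket σ P Q [σ g]) = (s * t) • rawBracket σ P Q [g] := by
    have := parity_rawBracket hσ [g] hP hQ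
    have h3 : IsFunction σ (t • Q) := hQt ▸ hQ.parity hσ
    rw [hPs, hQt, rawBracket_smul_left hσ s _ h3, rawBracket_smul_right t _ hP, smul_smul] at this
    exact this
  have e1 := LX [] hP hs (pm ht hu) P1 (Q [f]) g hQf
  have e2 := LX [] hQ ht (pm hs hu) Q1 (P [f]) g hPf
  have e3 := LX [] hP hs hu P1 f g hf
  have e4 := LX [] hQ ht hu Q1 f g hf
  have e5 := LX [Q []] hP (pm hs ht) hu P2 f g hf
  have e6 := LX [P []] hQ (pm ht hs) hu Q2 f g hf
  have e7 := LX [] hP hs hu P1 f (Q [g]) hf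
  have e8 := LX [] hQ ht hu Q1 f (P [g]) hf
  have a1 := hP.map_add [] [] (Q [f] * g)
    (((2⁻¹ : ℝ) * (1 + t + u - t * u)) • (f * Q [g]))
  have a2 := hQ.map_add [] [] (P [f] * g)
    (((2⁻¹ : ℝ) * (1 + s + u - s * u)) • (f * P [g]))
  have a3 := hP.map_smul [] [] ((2⁻¹ : ℝ) * (1 + t + u - t * u)) (f * Q [g])
  have a4 := hQ.map_smul [] [] ((2⁻¹ : ℝ) * (1 + s + u - s * u)) (f * P [g])
  simp only [List.nil_append, List.cons_append] at e1 e2 e3 e4 e5 e6 e7 e8 a1 a2 a3 a4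
  rw [hR, key (f * g), key f, key g, e3, e4, e5, e6, a1, a2, a3, a4, e1, e2, e7, e8]
  rcases hu with rfl | rfl
  · rw [one_smul] at hf
    rw [evenPart_of_even hf, oddPart_of_even hf]
    rcases hs with rfl | rfl <;> rcases ht with rfl | rfl <;> norm_num <;> noncomm_ring
  · rw [neg_one_smul] at hf
    rw [evenPart_of_odd hf, oddPart_of_odd hf]
    rcases hs with rfl | rfl <;> rcases ht with rfl | rfl <;> norm_num <;> noncomm_ring
theorem parity_halves (hσ : ∀ f, σ (σ f) = f) {P : List Ω → Ω} (hP : IsFunction σ P) :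
    ∃ P₀ P₁ : List Ω → Ω, IsFunction σ P₀ ∧ IsFunction σ P₁ ∧ P = P₀ + P₁ ∧
      parity σ P₀ = (1 : ℝ) • P₀ ∧ parity σ P₁ = (-1 : ℝ) • P₁ := by
  have h := hP.parity hσ
  refine ⟨(2⁻¹ : ℝ) • (P + parity σ P), (2⁻¹ : ℝ) • (P + (-1 : ℝ) • parity σ P),
    (hP.add h).smul _, (hP.add (h.smul _)).smul _, ?_, ?_, ?_⟩
  · module
  · rw [parity_smul, parity_add, parity_parity hσ]; module
  · rw [parity_smul, parity_add, parity_smul, parity_parity hσ]; module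

theorem rawBracket_leibniz (hσ : ∀ f, σ (σ f) = f) (l : List Ω) (f g : Ω) :
    ∀ {P Q : List Ω → Ω}, IsFunction σ P → IsFunction σ Q →
      rawBracket σ P Q (l ++ [f * g]) = rawBracket σ P Q (l ++ [f]) * g
        + evenPart σ f * rawBracket σ P Q (l ++ [g])
        + oddPart σ f * σ (rawBracket σ P Q (l ++ [σ g])) := by
  induction l with
  | nil =>
    intro P Q hP hQ
    obtain ⟨P₀, P₁, hP₀, hP₁, rfl, p₀, p₁⟩ := parity_halves hσ hP
    obtain ⟨Q₀, Q₁, hQ₀, hQ₁, rfl, q₀, q₁⟩ := parity_halves hσ hQ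
    have main : ∀ {P Q : List Ω → Ω} {s t : ℝ}, (s = 1 ∨ s = -1) → (t = 1 ∨ t = -1) →
        IsFunction σ P → IsFunction σ Q → parity σ P = s • P → parity σ Q = t • Q →
        rawBracket σ P Q [f * g] = rawBracket σ P Q [f] * g + evenPart σ f * rawBracket σ P Q [g]
          + oddPart σ f * σ (rawBracket σ P Q [σ g]) := by
      intro P Q s t hs ht hP hQ hPs hQt
      have k1 := rawBracket_leibniz_aux hσ hs ht (Or.inl rfl) hP hQ hPs hQt (evenPart σ f) g
        (by rw [apply_evenPart hσ, one_smul])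
      have k2 := rawBracket_leibniz_aux hσ hs ht (Or.inr rfl) hP hQ hPs hQt (oddPart σ f) g
        (by rw [apply_oddPart hσ, neg_one_smul])
      rw [evenPart_of_even (apply_evenPart hσ f), oddPart_of_even (apply_evenPart hσ f)] at k1
      rw [evenPart_of_odd (apply_oddPart hσ f), oddPart_of_odd (apply_oddPart hσ f)] at k2
      have a0 := rawBracket_map_add hσ [] [] (evenPart σ f * g) (oddPart σ f * g) hP hQ
      have a1 := rawBracket_map_add hσ [] [] (evenPart σ f) (oddPart σ f) hP hQ
      simp only [List.nil_append, ← add_mul, evenPart_add_oddPart] at a0 a1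
      rw [a0, a1, k1, k2]
      noncomm_ring
    have m00 := main (Or.inl rfl) (Or.inl rfl) hP₀ hQ₀ p₀ q₀
    have m01 := main (Or.inl rfl) (Or.inr rfl) hP₀ hQ₁ p₀ q₁
    have m10 := main (Or.inr rfl) (Or.inl rfl) hP₁ hQ₀ p₁ q₀
    have m11 := main (Or.inr rfl) (Or.inr rfl) hP₁ hQ₁ p₁ q₁
    simp only [List.nil_append, rawBracket_add_left hσ _ hQ, rawBracket_add_right _ hP₀,
      rawBracket_add_right _ hP₁, map_add, m00, m01, m10, m11]
    noncomm_ring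
  | cons a l ih =>
    intro P Q hP hQ
    simp only [List.cons_append, rawBracket, ih hP (hQ.contr _), ih (hP.contr _) hQ,
      ih (hP.contr _) (hQ.parity hσ), map_add]
    noncomm_ring

/-- The functions are closed under the big bracket. -/
theorem IsFunction.rawBracket (hσ : ∀ f, σ (σ f) = f) {P Q : List Ω → Ω}
    (hP : IsFunction σ P) (hQ : IsFunction σ Q) :
    IsFunction σ (SuperCotangent.rawBracket σ P Q) where
  map_add l l' f g := rawBracket_map_add hσ l l' f g hP hQ
  map_smul l l' c f := rawBracket_map_smul hσ l l' c f hP hQ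
  symm_even l l' f g hf := rawBracket_symm_even hσ l l' f g hf hP hQ
  symm_odd l l' f g hf hg := rawBracket_symm_odd hσ l l' f g hf hg hP hQ
  leibniz l f g := rawBracket_leibniz hσ l f g hP hQ
  polynomial := by
    obtain ⟨m, hm⟩ := hP.polynomial
    obtain ⟨n, hn⟩ := hQ.polynomial
    exact ⟨m + n, fun l hl => rawBracket_polynomial hσ l m n hP hQ hm hn hl⟩

end Super
section Constructors

variable {Ω : Type*} [Ring Ω] [Algebra ℝ Ω] {σ : Ω →ₐ[ℝ] Ω}

/-- A function on the base, as a function on the cotangent space. -/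
def rawForm (a : Ω) : List Ω → Ω
  | [] => a
  | _ :: _ => 0

theorem isFunction_rawForm (a : Ω) : IsFunction σ (rawForm a) where
  map_add l l' f g := by cases l <;> simp [rawForm]
  map_smul l l' c f := by cases l <;> simp [rawForm]
  symm_even l l' f g h := by cases l <;> simp [rawForm]
  symm_odd l l' f g h h' := by cases l <;> simp [rawForm]
  leibniz l f g := by cases l <;> simp [rawForm]
  polynomial := ⟨1, fun l hl => by cases l <;> simp_all [rawForm]⟩

/-- A vector field on the base, as a function of degree one in the momenta. -/
def rawDer (D : Ω →ₗ[ℝ] Ω) : List Ω → Ω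
  | [f] => D f
  | _ => 0

theorem isFunction_rawDer (D : Ω →ₗ[ℝ] Ω)
    (hD : ∀ f g, D (f * g) = D f * g + evenPart σ f * D g + oddPart σ f * σ (D (σ g))) :
    IsFunction σ (rawDer D) where
  map_add l l' f g := by
    rcases l with _ | ⟨a, l⟩ <;> rcases l' with _ | ⟨b, l'⟩ <;> simp [rawDer]
  map_smul l l' c f := by
    rcases l with _ | ⟨a, l⟩ <;> rcases l' with _ | ⟨b, l'⟩ <;> simp [rawDer]
  symm_even l l' f g h := by cases l <;> simp [rawDer]
  symm_odd l l' f g h h' := by cases l <;> simp [rawDer]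
  leibniz l f g := by cases l <;> simp [rawDer, hD]
  polynomial := ⟨2, fun l hl => by
    rcases l with _ | ⟨a, _ | ⟨b, l⟩⟩ <;> simp_all [rawDer]⟩

/-- A symmetric biderivation, as a function of degree two in the momenta. -/
def rawBider (B : Ω →ₗ[ℝ] Ω →ₗ[ℝ] Ω) : List Ω → Ω
  | [f, g] => B f g
  | _ => 0

theorem isFunction_rawBider (B : Ω →ₗ[ℝ] Ω →ₗ[ℝ] Ω)
    (h0 : ∀ f g, σ f = f → B f g = B g f)
    (h1 : ∀ f g, σ f = -f → σ g = -g → B f g = -B g f)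
    (hD : ∀ a f g, B a (f * g)
      = B a f * g + evenPart σ f * B a g + oddPart σ f * σ (B a (σ g))) :
    IsFunction σ (rawBider B) where
  map_add l l' f g := by
    rcases l with _ | ⟨a, _ | ⟨b, l⟩⟩ <;> rcases l' with _ | ⟨c, _ | ⟨d, l'⟩⟩ <;> simp [rawBider]
  map_smul l l' c f := by
    rcases l with _ | ⟨a, _ | ⟨b, l⟩⟩ <;> rcases l' with _ | ⟨c, _ | ⟨d, l'⟩⟩ <;> simp [rawBider]
  symm_even l l' f g h := by
    rcases l with _ | ⟨a, _ | ⟨b, l⟩⟩ <;> rcases l' with _ | ⟨c, l'⟩ <;> simp [rawBider]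
    exact h0 f g h
  symm_odd l l' f g h h' := by
    rcases l with _ | ⟨a, _ | ⟨b, l⟩⟩ <;> rcases l' with _ | ⟨c, l'⟩ <;> simp [rawBider]
    exact h1 f g h h'
  leibniz l f g := by
    rcases l with _ | ⟨a, _ | ⟨b, l⟩⟩ <;> simp [rawBider, hD]
  polynomial := ⟨3, fun l hl => by
    rcases l with _ | ⟨a, _ | ⟨b, _ | ⟨c, l⟩⟩⟩ <;> simp_all [rawBider]⟩

end Constructors

section Skew

variable {R : Type*} [CommRing R] {L N : Type*} [AddCommGroup L] [Module R L]
  [AddCommGroup N] [Module R N]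

/-- The linear map on `⋀² L` with `X ∧ Y ↦ b X Y - b Y X`. -/
noncomputable def skewLift (b : L →ₗ[R] L →ₗ[R] N) : ⋀[R]^2 L →ₗ[R] N :=
  exteriorPower.alternatingMapLinearEquiv
    { toFun := fun v => b (v 0) (v 1) - b (v 1) (v 0)
      map_update_add' := fun v i x y => by
        fin_cases i <;> simp [Function.update] <;> abel
      map_update_smul' := fun v i c x => by
        fin_cases i <;> simp [Function.update, smul_sub]
      map_eq_zero_of_eq' := fun v i j h hij => by
        fin_cases i <;> fin_cases j <;> simp_all }

/-- The element `X ∧ Y` of `⋀² L`. -/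
noncomputable def wedge (X Y : L) : ⋀[R]^2 L := exteriorPower.ιMulti R 2 ![X, Y]

@[simp] theorem skewLift_wedge (b : L →ₗ[R] L →ₗ[R] N) (X Y : L) :
    skewLift b (wedge X Y) = b X Y - b Y X := by
  simp [skewLift, wedge]

theorem coe_wedge (X Y : L) :
    ((wedge X Y : ⋀[R]^2 L) : ExteriorAlgebra R L)
      = ExteriorAlgebra.ι R X * ExteriorAlgebra.ι R Y := by
  simp [wedge, ExteriorAlgebra.ιMulti_apply]

theorem wedge_induction {p : ⋀[R]^2 L → Prop} (hw : ∀ X Y, p (wedge X Y)) (h0 : p 0)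
    (ha : ∀ x y, p x → p y → p (x + y)) (hs : ∀ (c : R) x, p x → p (c • x)) (x : ⋀[R]^2 L) :
    p x := by
  have hx : x ∈ Submodule.span R (Set.range (exteriorPower.ιMulti R 2 (M := L))) := by
    rw [exteriorPower.ιMulti_span]; trivial
  induction hx using Submodule.span_induction with
  | mem x hx =>
    obtain ⟨v, rfl⟩ := hx
    have : v = ![v 0, v 1] := by ext i; fin_cases i <;> rfl
    rw [this]; exact hw _ _
  | zero => exact h0
  | add x y _ _ hx hy => exact ha x y hx hy
  | smul c x _ hx => exact hs c x hx

end Skew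

section Forms

variable (R : Type*) [CommRing R] (L : Type*) [AddCommGroup L] [Module R L]

/-- `Ω(A) = Γ(⋀ A^*)`, as the exterior algebra of `Γ(A^*) = Hom_R(Γ(A), R)`, `R` being the ring of
smooth functions and `L = Γ(A)`. These are the functions on the supermanifold `ΠA`. -/
abbrev Forms : Type _ := ExteriorAlgebra R (Module.Dual R L)

variable {R L}

/-- A section of `A^*` as a form. -/
noncomputable abbrev cov (α : Module.Dual R L) : Forms R L := ExteriorAlgebra.ι R α

/-- A smooth function as a form of degree zero. -/
noncomputable abbrev fn (f : R) : Forms R L := algebraMap R (Forms R L) f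

/-- The interior product `i_X a = a(X, ·, …)`. -/
noncomputable def interior : L →ₗ[R] Forms R L →ₗ[R] Forms R L :=
  CliffordAlgebra.contractLeft (Q := (0 : QuadraticForm R (Module.Dual R L))) ∘ₗ
    Module.Dual.eval R L

@[simp] theorem interior_fn (X : L) (f : R) : interior X (fn f : Forms R L) = 0 :=
  CliffordAlgebra.contractLeft_algebraMap _ _ _

@[simp] theorem interior_cov (X : L) (α : Module.Dual R L) :
    interior X (cov α) = fn (α X) :=
  CliffordAlgebra.contractLeft_ι _ _ _

theorem interior_cov_mul (X : L) (α : Module.Dual R L) (b : Forms R L) :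
    interior X (cov α * b) = α X • b - cov α * interior X b :=
  CliffordAlgebra.contractLeft_ι_mul _ _ _

theorem forms_induction {p : Forms R L → Prop} (hf : ∀ f, p (fn f)) (hc : ∀ α, p (cov α))
    (hm : ∀ a b, p a → p b → p (a * b)) (ha : ∀ a b, p a → p b → p (a + b)) (a : Forms R L) :
    p a :=
  ExteriorAlgebra.induction hf hc hm ha a

variable [Algebra ℝ R] [Module ℝ L] [IsScalarTower ℝ R L]

variable (R L) in
/-- The parity involution `a ↦ (-1)^|a| a` of `Ω(A)`. -/
noncomputable def involution : Forms R L →ₐ[ℝ] Forms R L :=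
  (CliffordAlgebra.involute (Q := (0 : QuadraticForm R (Module.Dual R L)))).restrictScalars ℝ

theorem involution_involution (a : Forms R L) : involution R L (involution R L a) = a :=
  CliffordAlgebra.involute_involute a

@[simp] theorem involution_cov (α : Module.Dual R L) : involution R L (cov α) = -cov α :=
  CliffordAlgebra.involute_ι α

@[simp] theorem involution_fn (f : R) : involution R L (fn f) = fn f :=
  AlgHom.commutes (CliffordAlgebra.involute (Q := (0 : QuadraticForm R (Module.Dual R L)))) f

theorem involution_smul (f : R) (a : Forms R L) :
    involution R L (f • a) = f • involution R L a :=
  map_smul (CliffordAlgebra.involute (Q := (0 : QuadraticForm R (Module.Dual R L)))) f a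

theorem interior_mul (X : L) (a b : Forms R L) :
    interior X (a * b) = interior X a * b + involution R L a * interior X b := by
  induction a using forms_induction generalizing b with
  | hf f => simp [← Algebra.smul_def]
  | hc α => rw [interior_cov_mul, involution_cov, interior_cov, fn, ← Algebra.smul_def]; noncomm_ring
  | hm a c ha hc => rw [mul_assoc, ha, hc, ha, map_mul]; noncomm_ring
  | ha a c ha hc => rw [add_mul, map_add, ha, hc, map_add, map_add]; noncomm_ring

theorem involution_interior (X : L) (a : Forms R L) :
    involution R L (interior X a) = -interior X (involution R L a) := by
  induction a using forms_induction with
  | hf f => simp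
  | hc α => simp
  | hm a c ha hc =>
    rw [interior_mul, map_add, map_mul, map_mul, map_mul, interior_mul, ha, hc]; noncomm_ring
  | ha a c ha hc => rw [map_add, map_add, ha, hc, map_add, map_add]; abel

/-- Graded commutativity. -/
theorem graded_comm (a b : Forms R L) :
    a * b = evenPart (involution R L) b * a + oddPart (involution R L) b * involution R L a := by
  induction a using forms_induction generalizing b with
  | hf f =>
    rw [involution_fn, ← add_mul, evenPart_add_oddPart]
    exact Algebra.commutes f b
  | hc α =>
    have key : ∀ b : Forms R L, cov α * b = involution R L b * cov α := by
      intro b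
      induction b using forms_induction with
      | hf f => rw [involution_fn]; exact (Algebra.commutes f (cov α)).symm
      | hc β =>
        rw [involution_cov, eq_comm, neg_mul, neg_eq_iff_add_eq_zero]
        exact ExteriorAlgebra.ι_add_mul_swap β α
      | hm a c ha hc => rw [← mul_assoc, ha, mul_assoc, hc, ← mul_assoc, map_mul]
      | ha a c ha hc => rw [mul_add, ha, hc, map_add, add_mul]
    rw [key, involution_cov, mul_neg, ← sub_eq_add_neg, ← sub_mul]
    congr 1
    simp only [evenPart, oddPart]; module
  | hm a c ha hc =>
    have h0 := ha (evenPart (involution R L) b)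
    have h1 := ha (oddPart (involution R L) b)
    rw [evenPart_of_even (apply_evenPart involution_involution b),
      oddPart_of_even (apply_evenPart involution_involution b), zero_mul, add_zero] at h0
    rw [evenPart_of_odd (apply_oddPart involution_involution b),
      oddPart_of_odd (apply_oddPart involution_involution b), zero_mul, zero_add] at h1
    rw [mul_assoc, hc, mul_add, ← mul_assoc, ← mul_assoc, h0, h1, map_mul]
    noncomm_ring
  | ha a c ha hc => rw [add_mul, ha, hc, map_add]; noncomm_ring

end Forms

section Tensors

variable {R : Type*} [CommRing R] {L : Type*} [AddCommGroup L] [Module R L]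

/-- `π♯(α) = π(α, ·)`, where `(X ∧ Y)(α, β) = α(X) β(Y) - α(Y) β(X)`. -/
noncomputable def sharp : ⋀[R]^2 L →ₗ[R] Module.Dual R L →ₗ[R] L :=
  skewLift (N := Module.Dual R L →ₗ[R] L) (LinearMap.mk₂ R (fun X Y => (Module.Dual.eval R L X).smulRight Y)
    (fun X X' Y => by ext; simp [add_smul]) (fun c X Y => by ext; simp [mul_smul])
    (fun X Y Y' => by ext; simp) (fun c X Y => LinearMap.ext fun α => smul_comm (α X) c Y))

theorem sharp_wedge (X Y : L) (α : Module.Dual R L) :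
    sharp (wedge X Y) α = α X • Y - α Y • X := by
  simp [sharp]

/-- `ω♭(X) = ω(X, ·)`, where `(α ∧ β)(X, Y) = α(X) β(Y) - α(Y) β(X)`. -/
noncomputable def flat : ⋀[R]^2 (Module.Dual R L) →ₗ[R] L →ₗ[R] Module.Dual R L :=
  skewLift (L := Module.Dual R L) (N := L →ₗ[R] Module.Dual R L)
    (LinearMap.mk₂ R (fun α β => LinearMap.smulRight α β)
    (fun α α' β => by ext; simp [add_mul]) (fun c α β => by ext; simp [mul_assoc])
    (fun α β β' => by ext; simp [mul_add]) (fun c α β => by ext; simp [mul_left_comm]))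

theorem flat_wedge (α β : Module.Dual R L) (X : L) :
    flat (wedge α β) X = α X • β - β X • α := by
  simp [flat]

theorem interior_coe (ω : ⋀[R]^2 (Module.Dual R L)) (X : L) :
    interior X (ω : Forms R L) = cov (flat ω X) := by
  induction ω using wedge_induction with
  | hw α β =>
    rw [coe_wedge, flat_wedge, cov, map_sub, map_smul, map_smul]
    rw [show ExteriorAlgebra.ι R α * ExteriorAlgebra.ι R β = cov α * cov β from rfl,
      interior_cov_mul, interior_cov, fn, ← Algebra.commutes, ← Algebra.smul_def]
  | h0 => simp
  | ha x y hx hy => simp [hx, hy]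
  | hs c x hx => simp [hx]

/-- The algebra map `a ↦ a + ε i_N a` into dual numbers, used to construct `i_N`. -/
noncomputable def endLift (N : L →ₗ[R] L) : Forms R L →ₐ[R] TrivSqZeroExt (Forms R L) (Forms R L) :=
  ExteriorAlgebra.lift R
    ⟨(TrivSqZeroExt.inlAlgHom R (Forms R L) (Forms R L)).toLinearMap ∘ₗ ExteriorAlgebra.ι R
      + (TrivSqZeroExt.inrHom (Forms R L) (Forms R L)).restrictScalars R ∘ₗ
        ExteriorAlgebra.ι R ∘ₗ N.dualMap, fun α => by
      ext
      · simp
      · simp [ExteriorAlgebra.ι_add_mul_swap]⟩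

/-- `i_N`: the derivation of `Ω(A)` of degree zero which vanishes on functions and sends a one-form
`α` to `ᵗN α = α ∘ N`. -/
noncomputable def endDer (N : L →ₗ[R] L) : Forms R L →ₗ[R] Forms R L :=
  (TrivSqZeroExt.sndHom (Forms R L) (Forms R L)).restrictScalars R ∘ₗ (endLift N).toLinearMap

theorem fst_endLift (N : L →ₗ[R] L) (a : Forms R L) : (endLift N a).fst = a := by
  have : (TrivSqZeroExt.fstHom R (Forms R L) (Forms R L)).comp (endLift N) = AlgHom.id R _ := by
    ext α; simp [endLift]
  exact DFunLike.congr_fun this a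

theorem endDer_cov (N : L →ₗ[R] L) (α : Module.Dual R L) :
    endDer N (cov α) = cov (α ∘ₗ N) := by
  simp [endDer, endLift, LinearMap.dualMap_apply']

theorem endDer_fn (N : L →ₗ[R] L) (f : R) : endDer N (fn f : Forms R L) = 0 := by
  simp [endDer, TrivSqZeroExt.algebraMap_eq_inl']

theorem endDer_mul (N : L →ₗ[R] L) (a b : Forms R L) :
    endDer N (a * b) = endDer N a * b + a * endDer N b := by
  simp [endDer, fst_endLift, add_comm]

end Tensors


section Functions

variable (R : Type*) [CommRing R] [Algebra ℝ R] (L : Type*) [AddCommGroup L] [Module R L]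
  [Module ℝ L] [IsScalarTower ℝ R L]

/-- `C^∞(T^*ΠA)`: the functions on the cotangent space of the supermanifold `ΠA`. -/
def CotangentFunctions : Submodule ℝ (List (Forms R L) → Forms R L) where
  carrier := {P | IsFunction (involution R L) P}
  add_mem' hP hQ := hP.add hQ
  zero_mem' := IsFunction.zero
  smul_mem' c _ hP := hP.smul c

variable {R L}

noncomputable instance : CoeFun (CotangentFunctions R L) fun _ => List (Forms R L) → Forms R L :=
  ⟨Subtype.val⟩

/-- The big bracket: the canonical Poisson bracket on `C^∞(T^*ΠA)`. -/
noncomputable instance : Bracket (CotangentFunctions R L) (CotangentFunctions R L) :=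
  ⟨fun P Q => ⟨rawBracket (involution R L) P Q,
    IsFunction.rawBracket involution_involution P.2 Q.2⟩⟩

/-- A form as an element of `C^∞(T^*ΠA)`. -/
noncomputable def ofForm (a : Forms R L) : CotangentFunctions R L :=
  ⟨rawForm a, isFunction_rawForm a⟩

theorem involution_endDer (N : L →ₗ[R] L) (a : Forms R L) :
    involution R L (endDer N a) = endDer N (involution R L a) := by
  induction a using forms_induction with
  | hf f => rw [involution_fn, endDer_fn, map_zero]
  | hc α => rw [involution_cov, map_neg, endDer_cov, involution_cov]
  | hm a b ha hb => rw [endDer_mul, map_add, map_mul, map_mul, map_mul, endDer_mul, ha, hb]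
  | ha a b ha hb => rw [map_add, map_add, map_add, map_add, ha, hb]

/-- A `(1,1)`-tensor `N` as an element of `C^∞(T^*ΠA)` (of bidegree `(1,1)`): it acts as `i_N`, so that
`{X, N} = N X` for sections `X` of `A` and `{α, N} = -ᵗN α` for sections `α` of `A^*`. -/
noncomputable def ofEnd (N : L →ₗ[R] L) : CotangentFunctions R L :=
  ⟨rawDer ((endDer N).restrictScalars ℝ), isFunction_rawDer _ fun f g => by
    have h := evenPart_add_oddPart (σ := involution R L) f
    simp only [LinearMap.coe_restrictScalars, endDer_mul, involution_endDer,
      involution_involution]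
    rw [add_assoc, ← add_mul, h]⟩

/-- `(X ∧ Y, a, b) ↦ (-1)^|a| (i_X a · i_Y b - i_Y a · i_X b)`, which is `{{X Y, a}, b}`. -/
noncomputable def bivectorPairing :
    ⋀[R]^2 L →ₗ[R] Forms R L →ₗ[R] Forms R L →ₗ[R] Forms R L :=
  skewLift (N := Forms R L →ₗ[R] Forms R L →ₗ[R] Forms R L)
    (LinearMap.mk₂ R (fun X Y => (LinearMap.mul R (Forms R L)).compl₁₂
        (interior X ∘ₗ (CliffordAlgebra.involute
          (Q := (0 : QuadraticForm R (Module.Dual R L)))).toLinearMap) (interior Y))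
      (fun X X' Y => by ext; simp [add_mul]) (fun c X Y => by ext; simp)
      (fun X Y Y' => by ext; simp [mul_add]) (fun c X Y => by ext; simp))

theorem bivectorPairing_wedge (X Y : L) (a b : Forms R L) :
    bivectorPairing (wedge X Y) a b = interior X (involution R L a) * interior Y b
      - interior Y (involution R L a) * interior X b := by
  simp [bivectorPairing]; rfl

theorem bivectorPairing_symm_even (π : ⋀[R]^2 L) (f g : Forms R L) (hf : involution R L f = f) :
    bivectorPairing π f g = bivectorPairing π g f := by
  induction π using wedge_induction with
  | hw X Y =>
    have h : ∀ (X : L) (b : Forms R L), interior X f * b = involution R L b * interior X f := by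
      intro X b
      have := graded_comm (interior X f) b
      rw [involution_interior, hf, mul_neg, ← sub_eq_add_neg, ← sub_mul] at this
      rw [this]; congr 1
      simp only [evenPart, oddPart]; module
    rw [bivectorPairing_wedge, bivectorPairing_wedge, hf, h, h, involution_interior,
      involution_interior]
    noncomm_ring
  | h0 => simp
  | ha x y hx hy => simp [hx, hy]
  | hs c x hx => simp [hx]

theorem bivectorPairing_symm_odd (π : ⋀[R]^2 L) (f g : Forms R L) (hf : involution R L f = -f)
    (hg : involution R L g = -g) :
    bivectorPairing π f g = -bivectorPairing π g f := by
  induction π using wedge_induction with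
  | hw X Y =>
    have h : ∀ (X : L) (b : Forms R L), interior X f * b = b * interior X f := by
      intro X b
      have := graded_comm (interior X f) b
      rw [involution_interior, hf, map_neg, neg_neg, ← add_mul, evenPart_add_oddPart] at this
      exact this
    rw [bivectorPairing_wedge, bivectorPairing_wedge, hf, hg, map_neg, map_neg, map_neg, map_neg,
      neg_mul, neg_mul, h, h]
    noncomm_ring
  | h0 => simp
  | ha x y hx hy => simp [hx, hy]; abel
  | hs c x hx => simp [hx]

theorem bivectorPairing_leibniz (π : ⋀[R]^2 L) (a f g : Forms R L) :
    bivectorPairing π a (f * g) = bivectorPairing π a f * g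
      + evenPart (involution R L) f * bivectorPairing π a g
      + oddPart (involution R L) f
        * involution R L (bivectorPairing π a (involution R L g)) := by
  induction π using wedge_induction with
  | hw X Y =>
    have h : ∀ X Y : L, interior X (involution R L a) * interior Y (f * g)
        = interior X (involution R L a) * interior Y f * g
          + evenPart (involution R L) f * (interior X (involution R L a) * interior Y g)
          + oddPart (involution R L) f * involution R L
            (interior X (involution R L a) * interior Y (involution R L g)) := by
      intro X Y
      have e : involution R L f = evenPart (involution R L) f - oddPart (involution R L) f := by
        simp only [evenPart, oddPart]; module
      have k := graded_comm (interior X (involution R L a)) (involution R L f)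
      have k1 : evenPart (involution R L) (involution R L f) = evenPart (involution R L) f := by
        simp only [evenPart, involution_involution, add_comm]
      have k2 : oddPart (involution R L) (involution R L f) = -oddPart (involution R L) f := by
        simp only [oddPart, involution_involution]; module
      rw [k1, k2] at k
      rw [interior_mul, mul_add, ← mul_assoc, ← mul_assoc _ (involution R L f), k, map_mul,
        involution_interior Y, involution_involution]
      noncomm_ring
    rw [bivectorPairing_wedge, bivectorPairing_wedge, bivectorPairing_wedge,
      bivectorPairing_wedge, h, h, map_sub]
    noncomm_ring
  | h0 => simp
  | ha x y hx hy => simp only [map_add, LinearMap.add_apply, hx, hy]; noncomm_ring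
  | hs c x hx =>
    simp only [map_smul, LinearMap.smul_apply, hx, involution_smul, smul_add, smul_mul_assoc,
      mul_smul_comm]

/-- A bivector as an element of `C^∞(T^*ΠA)` (of bidegree `(2,0)`): `X ∧ Y` is the product of the
fibre-linear functions `X` and `Y`, so that `{α, π} = π♯ α` for sections `α` of `A^*`. -/
noncomputable def ofBivector (π : ⋀[R]^2 L) : CotangentFunctions R L :=
  ⟨rawBider (LinearMap.mk₂ ℝ (fun f g => bivectorPairing π f g)
      (fun f f' g => by simp) (fun c f g => by rw [LinearMap.map_smul_of_tower]; rfl)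
      (fun f g g' => by simp) (fun c f g => by rw [LinearMap.map_smul_of_tower])),
    isFunction_rawBider _ (bivectorPairing_symm_even π) (bivectorPairing_symm_odd π)
      (bivectorPairing_leibniz π)⟩

theorem dual_sharp (π : ⋀[R]^2 L) (α β : Module.Dual R L) : β (sharp π α) = -α (sharp π β) := by
  induction π using wedge_induction with
  | hw X Y => simp [sharp_wedge]; ring
  | h0 => simp
  | ha x y hx hy => simp [hx, hy]; ring
  | hs c x hx => simp [hx]

theorem flat_skew (ω : ⋀[R]^2 (Module.Dual R L)) (X Y : L) : flat ω X Y = -flat ω Y X := by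
  induction ω using wedge_induction with
  | hw α β => simp [flat_wedge]; ring
  | h0 => simp
  | ha x y hx hy => simp [hx, hy]; ring
  | hs c x hx => simp [hx]

theorem interior_endDer (N : L →ₗ[R] L) (X : L) (a : Forms R L) :
    interior X (endDer N a) = endDer N (interior X a) + interior (N X) a := by
  induction a using forms_induction with
  | hf f => simp only [endDer_fn, interior_fn, map_zero, add_zero]
  | hc α => simp only [endDer_cov, interior_cov, endDer_fn, zero_add, LinearMap.comp_apply]
  | hm a b ha hb =>
    rw [endDer_mul, map_add, interior_mul, interior_mul, interior_mul, interior_mul, map_add,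
      endDer_mul, endDer_mul, ha, hb, involution_endDer]
    noncomm_ring
  | ha a b ha hb => simp only [map_add, ha, hb]; abel

/-- `ω_N = ½ i_N ω`, that is, the form `½ (ω(N·, ·) + ω(·, N·))`. For `N = π♯ ∘ ω♭` this is
`ω(N·, ·)`, see `interior_omegaN`. -/
noncomputable def omegaN (ω : ⋀[R]^2 (Module.Dual R L)) (N : L →ₗ[R] L) : Forms R L :=
  (2⁻¹ : ℝ) • endDer N (ω : Forms R L)

/-- `ω_N(X, ·) = ω(N X, ·)` for `N = π♯ ∘ ω♭`. -/
theorem interior_omegaN (π : ⋀[R]^2 L) (ω : ⋀[R]^2 (Module.Dual R L)) (X : L) :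
    interior X (omegaN ω (sharp π ∘ₗ flat ω)) = cov (flat ω ((sharp π ∘ₗ flat ω) X)) := by
  have h : flat ω X ∘ₗ (sharp π ∘ₗ flat ω) = flat ω ((sharp π ∘ₗ flat ω) X) := by
    ext Y
    simp only [LinearMap.comp_apply]
    rw [dual_sharp, flat_skew, neg_neg]
  rw [omegaN, LinearMap.map_smul_of_tower, interior_endDer, interior_coe, interior_coe, endDer_cov,
    h]
  module

end Functions


section Structures

variable {R : Type*} [CommRing R] [Algebra ℝ R] {L : Type*} [AddCommGroup L] [Module R L]
  [Module ℝ L] [IsScalarTower ℝ R L]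

/-- `P` has bidegree `(ε, δ)`: it is homogeneous of degree `ε` in the momenta of `T^*ΠA → ΠA`, and, as
the big bracket lowers the total degree by two, it sends forms of degrees `k₁, …, k_ε` to a form of
degree `k₁ + … + k_ε + δ - ε` (so to zero if this number is negative). -/
def HasBidegree (P : List (Forms R L) → Forms R L) (ε δ : ℕ) : Prop :=
  (∀ l, l.length ≠ ε → P l = 0) ∧
    ∀ (l : List (Forms R L)) (k : List ℕ),
      List.Forall₂ (fun f i => f ∈ ⋀[R]^i (Module.Dual R L)) l k →
        (∀ m : ℕ, m + ε = k.sum + δ → P l ∈ ⋀[R]^m (Module.Dual R L)) ∧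
          (k.sum + δ < ε → P l = 0)

/-- The twist `e^τ P = ∑ₖ (1/k!) {…{{P, τ}, τ}, …, τ}`. -/
noncomputable def twist (τ P : CotangentFunctions R L) : CotangentFunctions R L :=
  ∑ᶠ k : ℕ, ((k.factorial : ℝ)⁻¹) • (fun Q : CotangentFunctions R L => ⁅Q, τ⁆)^[k] P

/-- The series defining `e^τ P` is a finite sum. -/
def TwistTerminates (τ P : CotangentFunctions R L) : Prop :=
  ∃ n : ℕ, ∀ k ≥ n, (fun Q : CotangentFunctions R L => ⁅Q, τ⁆)^[k] P = 0

variable (R L) in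
/-- A Lie algebroid structure on `A`, with `L = Γ(A)`: a Lie bracket on the sections and an anchor,
given on sections as a function-linear map to vector fields (derivations of the ring of functions),
subject to the Leibniz rule. -/
structure LieAlgebroid where
  bracket : L →ₗ[ℝ] L →ₗ[ℝ] L
  anchor : L →ₗ[R] Derivation ℝ R R
  bracket_self : ∀ X, bracket X X = 0
  jacobi : ∀ X Y Z,
    bracket X (bracket Y Z) + bracket Y (bracket Z X) + bracket Z (bracket X Y) = 0
  leibniz : ∀ (X Y : L) (f : R), bracket X (f • Y) = f • bracket X Y + anchor X f • Y

namespace LieAlgebroid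

variable (𝓐 : LieAlgebroid R L)

/-- `μ` is the function on `T^*ΠA` that corresponds to the Lie algebroid structure: it has bidegree
`(1, 2)` (shifted bidegree `(0, 1)`), `{μ, ·}` is the differential `d` of the algebroid,
`d f (X) = ρ(X) f` and `dα(X, Y) = ρ(X) α(Y) - ρ(Y) α(X) - α([X, Y])`, and `{μ, μ} = 0`.
Elements of bidegree `(1, 2)` are the derivations of degree one of `Ω(A)`, with `d a = μ [a]`. -/
structure IsHamiltonian (μ : CotangentFunctions R L) : Prop where
  bidegree : HasBidegree μ 1 2
  apply_fn : ∀ (f : R) (X : L), interior X (μ [fn f]) = fn (𝓐.anchor X f)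
  apply_cov : ∀ (α : Module.Dual R L) (X Y : L),
    interior Y (interior X (μ [cov α]))
      = fn (𝓐.anchor X (α Y) - 𝓐.anchor Y (α X) - α (𝓐.bracket X Y))
  bracket_self_eq_zero : ⁅μ, μ⁆ = 0

/-- The Schouten-Nijenhuis bracket `[X₁ ∧ X₂, Y₁ ∧ Y₂]`, equal to
`∑ (-1)^(i+j) [X_i, Y_j] ∧ X_{3-i} ∧ Y_{3-j}`. -/
noncomputable def schoutenWedge (X₁ X₂ Y₁ Y₂ : L) : ExteriorAlgebra R L :=
  let e := ExteriorAlgebra.ι R (M := L)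
  e (𝓐.bracket X₁ Y₁) * e X₂ * e Y₂ - e (𝓐.bracket X₁ Y₂) * e X₂ * e Y₁
    - e (𝓐.bracket X₂ Y₁) * e X₁ * e Y₂ + e (𝓐.bracket X₂ Y₂) * e X₁ * e Y₁

/-- `[π, π]_SN = 0`: write `π` as a finite sum of wedges and expand biadditively (the outcome does not
depend on how `π` is written). -/
def IsPoisson (π : ⋀[R]^2 L) : Prop :=
  ∃ (k : ℕ) (X Y : Fin k → L), π = ∑ i, wedge (X i) (Y i) ∧
    ∑ i, ∑ j, 𝓐.schoutenWedge (X i) (Y i) (X j) (Y j) = 0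

end LieAlgebroid

/-- The Lie derivative `i_X d + d i_X`, with `d = {μ, ·}`. -/
noncomputable def lieDerivative (μ : CotangentFunctions R L) (X : L) (a : Forms R L) : Forms R L :=
  interior X (μ [a]) + μ [interior X a]

/-- `[α, β]_π = L_{π♯α} β - L_{π♯β} α - d(π(α, β))`. -/
noncomputable def koszulBracket (μ : CotangentFunctions R L) (π : ⋀[R]^2 L)
    (α β : Module.Dual R L) : Forms R L :=
  lieDerivative μ (sharp π α) (cov β) - lieDerivative μ (sharp π β) (cov α)
    - μ [fn (β (sharp π α))]

/-- `P` is the function on `T^*ΠA` of bidegree `(2, 1)` that corresponds to the bracket `[·,·]_π` and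
the anchor `ρ ∘ π♯` on `A^*`: `{{P, α}, β} = [α, β]_π` and `{{P, α}, f} = ρ(π♯ α) f`. -/
structure IsKoszulHamiltonian (𝓐 : LieAlgebroid R L) (μ : CotangentFunctions R L)
    (π : ⋀[R]^2 L) (P : CotangentFunctions R L) : Prop where
  bidegree : HasBidegree P 2 1
  apply_cov_cov : ∀ α β : Module.Dual R L, P [cov α, cov β] = koszulBracket μ π α β
  apply_cov_fn : ∀ (α : Module.Dual R L) (f : R),
    P [cov α, fn f] = fn (𝓐.anchor (sharp π α) f)

/-- `d_N = {{N, μ}, ·} = i_N d - d i_N`. -/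
noncomputable def deformedDifferential (μ : CotangentFunctions R L) (N : L →ₗ[R] L)
    (a : Forms R L) : Forms R L :=
  endDer N (μ [a]) - μ [endDer N a]

/-- `P` is the function on `T^*ΠA` of bidegree `(1, 2)`, i.e. the derivation of degree one of
`Ω(A) = Γ(⋀ A^*)`, given by `f ↦ d_N f` on functions and `α ↦ d_N α + i_{π♯α} H` on sections of
`A^*`. -/
structure IsBackgroundDerivation (μ : CotangentFunctions R L) (π : ⋀[R]^2 L) (N : L →ₗ[R] L)
    (H : Forms R L) (P : CotangentFunctions R L) : Prop where
  bidegree : HasBidegree P 1 2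
  apply_fn : ∀ f : R, P [fn f] = deformedDifferential μ N (fn f)
  apply_cov : ∀ α : Module.Dual R L,
    P [cov α] = deformedDifferential μ N (cov α) + interior (sharp π α) H

/-- The function `{π + N, μ + H} + ψ` on `T^*ΠA`: the Lie quasi-bialgebroid structure on `(A^*, A)`
induced by `(π, N, ψ, H)`. -/
noncomputable def inducedStructure (μ : CotangentFunctions R L) (π : ⋀[R]^2 L) (N : L →ₗ[R] L)
    (ψ H : Forms R L) : CotangentFunctions R L :=
  ⁅ofBivector π + ofEnd N, μ + ofForm H⁆ + ofForm ψ

end Structures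

section Manifold
open scoped Manifold ContDiff Bundle

variable {n : ℕ} {M : Type*} [TopologicalSpace M] [ChartedSpace (EuclideanSpace ℝ (Fin n)) M]
  {F : Type*} [NormedAddCommGroup F] [NormedSpace ℝ F] {A : M → Type*}
  [TopologicalSpace (Bundle.TotalSpace F A)] [∀ x, TopologicalSpace (A x)] [FiberBundle F A]
  [∀ x, AddCommGroup (A x)] [∀ x, Module ℝ (A x)] [VectorBundle ℝ F A]

/-- Sections of a smooth vector bundle form a module over the smooth functions. -/
noncomputable instance sectionModule :
    Module C^∞⟮𝓡 n, M; ℝ⟯ Cₛ^∞⟮𝓡 n; F, A⟯ where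
  smul f s := ⟨fun x => f x • s x, f.contMDiff.smul_section s.contMDiff⟩
  one_smul s := by ext x; exact one_smul ℝ (s x)
  mul_smul f g s := by ext x; exact mul_smul (f x) (g x) (s x)
  smul_zero f := by ext x; exact smul_zero (f x)
  smul_add f s t := by ext x; exact smul_add (f x) (s x) (t x)
  add_smul f g s := by ext x; exact add_smul (f x) (g x) (s x)
  zero_smul s := by ext x; exact zero_smul ℝ (s x)

instance sectionIsScalarTower :
    IsScalarTower ℝ C^∞⟮𝓡 n, M; ℝ⟯ Cₛ^∞⟮𝓡 n; F, A⟯ where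
  smul_assoc c f s := by ext x; exact smul_assoc c (f x) (s x)

end Manifold

end SuperCotangent

open SuperCotangent
open scoped Manifold ContDiff

/-!
The function `μ_π = {π, μ}` is the first-order term of `e^{-π} μ`. Its bracket with `π` has bidegree
`(3, 0)`, hence is determined by its values on triples of one-forms, where it is the
Schouten-Nijenhuis bracket `[π, π] = 0`; so `e^{-π} μ = μ + μ_π`, and the Jacobi identity gives
`{μ_π, μ_π} = 0`. In the same way every function of small bidegree is determined by its values on
`C^∞(M)` and `Γ(A^*)`, which identifies `μ_π` and `d_N^H = {N, μ} + {π, H}`.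

From `{π, ω} = -N` and `{μ, ω} = -H` one gets `{μ_π, ω} = -d_N^H`,
`{d_N^H, ω} = -2 (ψ + i_N H)` and `{ψ + i_N H, ω} = 0`, so `e^{-ω} μ_π` is exactly the expansion of
`{π + N, μ + H} + ψ`. As `ω` is even, bracketing with it is a derivation of the big bracket, so
`e^{-ω}` preserves brackets and `{S, S} = e^{-ω} {μ_π, μ_π} = 0`.
-/

namespace SuperCotangent

section Parity

variable {Ω : Type*} [Ring Ω] [Algebra ℝ Ω]

/-- `a` is homogeneous for the involution `σ`, and `s` is the sign `(-1)^|a|`. -/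
structure HasSign (σ : Ω →ₐ[ℝ] Ω) (a : Ω) (s : ℝ) : Prop where
  sign : s = 1 ∨ s = -1
  apply_eq : σ a = s • a

/-- `P` is a function on the cotangent space that is homogeneous for the parity, and `s` is the sign
`(-1)^|P|`. -/
structure HasParity (σ : Ω →ₐ[ℝ] Ω) (P : List Ω → Ω) (s : ℝ) : Prop where
  isFunction : IsFunction σ P
  sign : s = 1 ∨ s = -1
  parity_eq : parity σ P = s • P

/-- The sign `(-1)^(|a| |b|)` in terms of `s = (-1)^|a|` and `t = (-1)^|b|`. -/
noncomputable def koszulSign (s t : ℝ) : ℝ := 2⁻¹ * (1 + s + t - s * t)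

theorem koszulSign_one_left (t : ℝ) : koszulSign 1 t = 1 := by
  simp only [koszulSign]; ring

theorem koszulSign_one_right (s : ℝ) : koszulSign s 1 = 1 := by
  simp only [koszulSign]; ring

theorem koszulSign_neg_one_neg_one : koszulSign (-1) (-1) = -1 := by
  norm_num [koszulSign]

theorem sign_mul {s t : ℝ} (hs : s = 1 ∨ s = -1) (ht : t = 1 ∨ t = -1) :
    s * t = 1 ∨ s * t = -1 := by
  rcases hs with rfl | rfl <;> rcases ht with rfl | rfl <;> simp

variable {σ : Ω →ₐ[ℝ] Ω} {P Q R : List Ω → Ω} {a b : Ω} {p q r s t u : ℝ}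

theorem hasSign_evenPart (hσ : ∀ f, σ (σ f) = f) (a : Ω) : HasSign σ (evenPart σ a) 1 :=
  ⟨Or.inl rfl, by rw [apply_evenPart hσ, one_smul]⟩

theorem hasSign_oddPart (hσ : ∀ f, σ (σ f) = f) (a : Ω) : HasSign σ (oddPart σ a) (-1) :=
  ⟨Or.inr rfl, by rw [apply_oddPart hσ, neg_one_smul]⟩

theorem HasParity.apply_nil (hP : HasParity σ P s) : HasSign σ (P []) s :=
  ⟨hP.sign, congrFun hP.parity_eq []⟩

theorem HasParity.contr (hσ : ∀ f, σ (σ f) = f) (hP : HasParity σ P s) (ha : HasSign σ a t) :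
    HasParity σ (contr P a) (s * t) :=
  ⟨hP.isFunction.contr a, sign_mul hP.sign ha.sign,
    parity_contr hσ hP.isFunction hP.parity_eq ha.apply_eq⟩

theorem HasParity.rawBracket (hσ : ∀ f, σ (σ f) = f) (hP : HasParity σ P s)
    (hQ : HasParity σ Q t) : HasParity σ (rawBracket σ P Q) (s * t) := by
  refine ⟨hP.isFunction.rawBracket hσ hQ.isFunction, sign_mul hP.sign hQ.sign, funext fun l => ?_⟩
  rw [parity_rawBracket hσ l hP.isFunction hQ.isFunction, hP.parity_eq, hQ.parity_eq,
    rawBracket_smul_left hσ s _ (hQ.isFunction.smul t), rawBracket_smul_right t _ hP.isFunction,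
    smul_smul, Pi.smul_apply]

theorem IsFunction.exists_hasParity_add (hσ : ∀ f, σ (σ f) = f) (hP : IsFunction σ P) :
    ∃ P₀ P₁, HasParity σ P₀ 1 ∧ HasParity σ P₁ (-1) ∧ P = P₀ + P₁ := by
  obtain ⟨P₀, P₁, h₀, h₁, hadd, hp₀, hp₁⟩ := parity_halves hσ hP
  exact ⟨P₀, P₁, ⟨h₀, Or.inl rfl, hp₀⟩, ⟨h₁, Or.inr rfl, hp₁⟩, hadd⟩

theorem IsFunction.apply_pair_swap (hP : IsFunction σ P) (ha : HasSign σ a s) (hb : HasSign σ b t)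
    (l : List Ω) : P (a :: b :: l) = koszulSign s t • P (b :: a :: l) := by
  obtain ⟨rfl | rfl, ha⟩ := ha
  · rw [koszulSign_one_left, one_smul]
    exact hP.symm_even [] l a b (by simpa only [one_smul] using ha)
  · obtain ⟨rfl | rfl, hb⟩ := hb
    · rw [koszulSign_one_right, one_smul]
      exact (hP.symm_even [] l b a (by simpa only [one_smul] using hb)).symm
    · rw [koszulSign_neg_one_neg_one, neg_one_smul]
      exact hP.symm_odd [] l a b (by simpa only [neg_one_smul] using ha)
        (by simpa only [neg_one_smul] using hb)

theorem IsFunction.apply_cons_eq_of_hasSign (hσ : ∀ f, σ (σ f) = f) (hP : IsFunction σ P)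
    (hQ : IsFunction σ Q) {l : List Ω}
    (h : ∀ {u : ℝ} {f : Ω}, HasSign σ f u → P (f :: l) = Q (f :: l)) (f : Ω) :
    P (f :: l) = Q (f :: l) := by
  have halves {T : List Ω → Ω} (hT : IsFunction σ T) :
      T (f :: l) = T (evenPart σ f :: l) + T (oddPart σ f :: l) := by
    rw [← evenPart_add_oddPart (σ := σ) f]
    simpa only [List.nil_append, evenPart_add_oddPart] using
      hT.map_add [] l (evenPart σ f) (oddPart σ f)
  rw [halves hP, halves hQ, h (hasSign_evenPart hσ f), h (hasSign_oddPart hσ f)]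

theorem IsFunction.apply_singleton_sub_smul (hP : IsFunction σ P) (a b : Ω) (c : ℝ) :
    P [a - c • b] = P [a] - c • P [b] := by
  have hadd := hP.map_add [] [] a ((-c) • b)
  have hsmul := hP.map_smul [] [] (-c) b
  simp only [List.nil_append] at hadd hsmul
  rw [sub_eq_add_neg, ← neg_smul, hadd, hsmul, neg_smul, ← sub_eq_add_neg]

end Parity

section Jacobi

variable {Ω : Type*} [Ring Ω] [Algebra ℝ Ω] {σ : Ω →ₐ[ℝ] Ω} {P Q R : List Ω → Ω} {f : Ω}
  {p q r s t u : ℝ}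

theorem rawBracket_nil_of_hasParity (hP : HasParity σ P s) (hQ : HasParity σ Q t) :
    rawBracket σ P Q [] = P [Q []] - koszulSign s t • Q [P []] := by
  rw [rawBracket, koszulSign_aux hP.sign hQ.sign hQ.isFunction hQ.parity_eq []
    hP.apply_nil.apply_eq, koszulSign]

theorem contr_rawBracket_of_hasParity (hσ : ∀ f, σ (σ f) = f) (hP : IsFunction σ P)
    (hQ : HasParity σ Q t) (hf : HasSign σ f u) :
    contr (rawBracket σ P Q) f
      = rawBracket σ P (contr Q f) + koszulSign u t • rawBracket σ (contr P f) Q := by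
  funext l
  simp only [contr, Pi.add_apply, Pi.smul_apply]
  rw [rawBracket]
  obtain ⟨rfl | rfl, hf⟩ := hf
  · rw [one_smul] at hf
    rw [evenPart_of_even hf, oddPart_of_even hf, hP.contr_zero,
      rawBracket_zero_left hσ (hQ.isFunction.parity hσ), koszulSign_one_left, one_smul, add_zero]
  · rw [neg_one_smul] at hf
    rw [evenPart_of_odd hf, oddPart_of_odd hf, hP.contr_zero,
      rawBracket_zero_left hσ hQ.isFunction, hQ.parity_eq,
      rawBracket_smul_right _ _ (hP.contr f), add_zero]
    rcases hQ.sign with rfl | rfl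
    · rw [koszulSign_one_right]
    · rw [koszulSign_neg_one_neg_one]

theorem rawBracket_cons_of_hasParity (hσ : ∀ f, σ (σ f) = f) (hP : IsFunction σ P)
    (hQ : HasParity σ Q t) (hf : HasSign σ f u) (l : List Ω) :
    rawBracket σ P Q (f :: l)
      = rawBracket σ P (contr Q f) l + koszulSign u t • rawBracket σ (contr P f) Q l :=
  congrFun (contr_rawBracket_of_hasParity hσ hP hQ hf) l

theorem rawBracket_singleton_of_hasParity (hσ : ∀ f, σ (σ f) = f) (hP : HasParity σ P s)
    (hQ : HasParity σ Q t) (hf : HasSign σ f u) :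
    rawBracket σ P Q [f] = P [Q [f]] - koszulSign s (t * u) • Q [f, P []]
      + koszulSign u t • (P [f, Q []] - koszulSign (s * u) t • Q [P [f]]) := by
  rw [rawBracket_cons_of_hasParity hσ hP.isFunction hQ hf,
    rawBracket_nil_of_hasParity hP (hQ.contr hσ hf),
    rawBracket_nil_of_hasParity (hP.contr hσ hf) hQ]
  rfl

theorem rawBracket_swap (hσ : ∀ f, σ (σ f) = f) (hP : HasParity σ P s) (hQ : HasParity σ Q t)
    (l : List Ω) : rawBracket σ P Q l = -(koszulSign s t • rawBracket σ Q P l) := by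
  induction l generalizing P Q s t with
  | nil =>
    rw [rawBracket_nil_of_hasParity hP hQ, rawBracket_nil_of_hasParity hQ hP]
    rcases hP.sign with rfl | rfl <;> rcases hQ.sign with rfl | rfl <;>
      simp only [koszulSign_one_left, koszulSign_one_right, koszulSign_neg_one_neg_one] <;> module
  | cons f l ih =>
    rw [← Pi.smul_apply, ← Pi.neg_apply, ← neg_smul]
    refine (hP.rawBracket hσ hQ).isFunction.apply_cons_eq_of_hasSign hσ
      ((hQ.rawBracket hσ hP).isFunction.smul _) (fun {u f} hf => ?_) f
    rw [Pi.smul_apply, rawBracket_cons_of_hasParity hσ hP.isFunction hQ hf,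
      rawBracket_cons_of_hasParity hσ hQ.isFunction hP hf,
      ih hP (hQ.contr hσ hf), ih (hP.contr hσ hf) hQ]
    rcases hP.sign with rfl | rfl <;> rcases hQ.sign with rfl | rfl <;>
      rcases hf.sign with rfl | rfl <;>
      simp only [koszulSign_one_left, koszulSign_one_right, koszulSign_neg_one_neg_one, mul_one,
        mul_neg, neg_neg] <;> module

theorem rawBracket_jacobi_nil (hσ : ∀ f, σ (σ f) = f) (hP : HasParity σ P p)
    (hQ : HasParity σ Q q) (hR : HasParity σ R r) :
    rawBracket σ (rawBracket σ P Q) R [] = rawBracket σ P (rawBracket σ Q R) []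
      + koszulSign q r • rawBracket σ (rawBracket σ P R) Q [] := by
  rw [rawBracket_nil_of_hasParity (hP.rawBracket hσ hQ) hR,
    rawBracket_nil_of_hasParity hP (hQ.rawBracket hσ hR),
    rawBracket_nil_of_hasParity (hP.rawBracket hσ hR) hQ,
    rawBracket_singleton_of_hasParity hσ hP hQ hR.apply_nil,
    rawBracket_singleton_of_hasParity hσ hQ hR hP.apply_nil,
    rawBracket_singleton_of_hasParity hσ hP hR hQ.apply_nil,
    rawBracket_nil_of_hasParity hP hQ, rawBracket_nil_of_hasParity hQ hR,
    rawBracket_nil_of_hasParity hP hR, hP.isFunction.apply_singleton_sub_smul,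
    hQ.isFunction.apply_singleton_sub_smul, hR.isFunction.apply_singleton_sub_smul,
    hP.isFunction.apply_pair_swap hR.apply_nil hQ.apply_nil,
    hQ.isFunction.apply_pair_swap hR.apply_nil hP.apply_nil,
    hR.isFunction.apply_pair_swap hQ.apply_nil hP.apply_nil]
  rcases hP.sign with rfl | rfl <;> rcases hQ.sign with rfl | rfl <;>
    rcases hR.sign with rfl | rfl <;>
    simp only [koszulSign_one_left, koszulSign_one_right, koszulSign_neg_one_neg_one, mul_one,
      mul_neg, neg_neg] <;> module

theorem rawBracket_add_smul_left (hσ : ∀ f, σ (σ f) = f) (c : ℝ) (hR : IsFunction σ R)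
    (l : List Ω) :
    rawBracket σ (P + c • Q) R l = rawBracket σ P R l + c • rawBracket σ Q R l := by
  rw [rawBracket_add_left hσ l hR, rawBracket_smul_left hσ c l hR]

theorem rawBracket_add_smul_right (c : ℝ) (hP : IsFunction σ P) (l : List Ω) :
    rawBracket σ P (Q + c • R) l = rawBracket σ P Q l + c • rawBracket σ P R l := by
  rw [rawBracket_add_right l hP, rawBracket_smul_right c l hP]

theorem rawBracket_jacobi (hσ : ∀ f, σ (σ f) = f) (hP : HasParity σ P p)
    (hQ : HasParity σ Q q) (hR : HasParity σ R r) (l : List Ω) :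
    rawBracket σ (rawBracket σ P Q) R l = rawBracket σ P (rawBracket σ Q R) l
      + koszulSign q r • rawBracket σ (rawBracket σ P R) Q l := by
  induction l generalizing P Q R p q r with
  | nil => exact rawBracket_jacobi_nil hσ hP hQ hR
  | cons f l ih =>
    have hPQ := hP.rawBracket hσ hQ
    have hQR := hQ.rawBracket hσ hR
    have hPR := hP.rawBracket hσ hR
    refine (hPQ.rawBracket hσ hR).isFunction.apply_cons_eq_of_hasSign hσ
      ((hP.rawBracket hσ hQR).isFunction.add
        ((hPR.rawBracket hσ hQ).isFunction.smul (koszulSign q r))) (fun {u f} hf => ?_) f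
    rw [Pi.add_apply, Pi.smul_apply, rawBracket_cons_of_hasParity hσ hPQ.isFunction hR hf,
      rawBracket_cons_of_hasParity hσ hP.isFunction hQR hf,
      rawBracket_cons_of_hasParity hσ hPR.isFunction hQ hf,
      contr_rawBracket_of_hasParity hσ hP.isFunction hQ hf,
      contr_rawBracket_of_hasParity hσ hQ.isFunction hR hf,
      contr_rawBracket_of_hasParity hσ hP.isFunction hR hf]
    simp only [rawBracket_add_smul_left hσ _ hR.isFunction,
      rawBracket_add_smul_left hσ _ hQ.isFunction, rawBracket_add_smul_right _ hP.isFunction,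
      ih hP hQ (hR.contr hσ hf), ih hP (hQ.contr hσ hf) hR, ih (hP.contr hσ hf) hQ hR]
    rcases hQ.sign with rfl | rfl <;> rcases hR.sign with rfl | rfl <;>
      rcases hf.sign with rfl | rfl <;>
      simp only [koszulSign_one_left, koszulSign_one_right, koszulSign_neg_one_neg_one, mul_one,
        mul_neg, neg_neg] <;> module

end Jacobi

section Generators

variable {Ω : Type*} [Ring Ω] [Algebra ℝ Ω] {σ : Ω →ₐ[ℝ] Ω} {P Q : List Ω → Ω}

theorem IsFunction.apply_zero_cons (hP : IsFunction σ P) (l : List Ω) : P (0 :: l) = 0 :=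
  congrFun hP.contr_zero l

theorem IsFunction.apply_singleton_mul (hP : IsFunction σ P) (a b : Ω) :
    P [a * b] = P [a] * b + evenPart σ a * P [b] + oddPart σ a * σ (P [σ b]) :=
  hP.leibniz [] a b

theorem IsFunction.apply_singleton_algebraMap (hP : IsFunction σ P) (c : ℝ) :
    P [algebraMap ℝ Ω c] = 0 := by
  have hone : P [1] = 0 := by
    have := hP.apply_singleton_mul 1 1
    rwa [evenPart_of_even (map_one σ), oddPart_of_even (map_one σ), mul_one, mul_one, one_mul,
      zero_mul, add_zero, left_eq_add] at this
  have hsmul : P [c • 1] = c • P [1] := congrFun (hP.contr_smul c 1) []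
  rw [Algebra.algebraMap_eq_smul_one, hsmul, hone, smul_zero]

theorem IsFunction.apply_singleton_eq_zero_of_adjoin (hσ : ∀ f, σ (σ f) = f)
    (hP : IsFunction σ P) {s : Set Ω} (hs : Algebra.adjoin ℝ s = ⊤)
    (hsign : ∀ a ∈ s, ∃ u, HasSign σ a u) (h : ∀ a ∈ s, P [a] = 0) (f : Ω) : P [f] = 0 := by
  have hadd (a b : Ω) : P [a + b] = P [a] + P [b] := congrFun (hP.contr_add a b) []
  -- The graded Leibniz rule involves `σ`, so the induction has to carry `P [σ f] = 0` along.
  suffices P [f] = 0 ∧ P [σ f] = 0 from this.1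
  have hf : f ∈ Algebra.adjoin ℝ s := hs ▸ Algebra.mem_top
  induction hf using Algebra.adjoin_induction with
  | mem a ha =>
    obtain ⟨u, hu⟩ := hsign a ha
    have hsmul : P [u • a] = u • P [a] := congrFun (hP.contr_smul u a) []
    rw [hu.apply_eq, hsmul, h a ha, smul_zero]
    exact ⟨rfl, rfl⟩
  | algebraMap c =>
    rw [AlgHom.commutes]
    exact ⟨hP.apply_singleton_algebraMap c, hP.apply_singleton_algebraMap c⟩
  | add a b _ _ ha hb =>
    rw [_root_.map_add, hadd, hadd, ha.1, ha.2, hb.1, hb.2, add_zero]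
    exact ⟨rfl, rfl⟩
  | mul a b _ _ ha hb =>
    rw [_root_.map_mul, hP.apply_singleton_mul, hP.apply_singleton_mul, hσ, ha.1, ha.2, hb.1, hb.2]
    simp only [zero_mul, mul_zero, _root_.map_zero, add_zero, and_self]

theorem IsFunction.apply_cons_eq_zero_of_adjoin (hσ : ∀ f, σ (σ f) = f) (hP : IsFunction σ P)
    {s : Set Ω} (hs : Algebra.adjoin ℝ s = ⊤) (hsign : ∀ a ∈ s, ∃ u, HasSign σ a u)
    (h : ∀ l : List Ω, (∀ a ∈ l, a ∈ s) → P l = 0) {l : List Ω} (hl : ∀ a ∈ l, a ∈ s) (f : Ω) :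
    P (f :: l) = 0 := by
  induction l generalizing P f with
  | nil =>
    exact hP.apply_singleton_eq_zero_of_adjoin hσ hs hsign
      (fun a ha => h [a] (by simpa only [List.mem_singleton, forall_eq] using ha)) f
  | cons g l ih =>
    rw [List.forall_mem_cons] at hl
    obtain ⟨u, hg⟩ := hsign g hl.1
    refine hP.apply_cons_eq_of_hasSign hσ IsFunction.zero (fun {v f} hf => ?_) f
    have hgf : P (g :: f :: l) = 0 :=
      ih (hP.contr g) (fun l' hl' => h (g :: l') (List.forall_mem_cons.mpr ⟨hl.1, hl'⟩)) hl.2 f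
    rw [hP.apply_pair_swap hf hg, hgf, smul_zero, Pi.zero_apply]

theorem IsFunction.eq_zero_of_adjoin (hσ : ∀ f, σ (σ f) = f) (hP : IsFunction σ P)
    {s : Set Ω} (hs : Algebra.adjoin ℝ s = ⊤) (hsign : ∀ a ∈ s, ∃ u, HasSign σ a u)
    (h : ∀ l : List Ω, (∀ a ∈ l, a ∈ s) → P l = 0) : P = 0 := by
  funext l
  induction l generalizing P with
  | nil => exact h [] (by simp)
  | cons f _ ih =>
    exact ih (hP.contr f) fun _ hl => hP.apply_cons_eq_zero_of_adjoin hσ hs hsign h hl f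

theorem IsFunction.ext_of_adjoin (hσ : ∀ f, σ (σ f) = f) (hP : IsFunction σ P)
    (hQ : IsFunction σ Q) {s : Set Ω} (hs : Algebra.adjoin ℝ s = ⊤)
    (hsign : ∀ a ∈ s, ∃ u, HasSign σ a u) (h : ∀ l : List Ω, (∀ a ∈ l, a ∈ s) → P l = Q l) :
    P = Q := by
  have hzero : P + (-1 : ℝ) • Q = 0 :=
    (hP.add (hQ.smul (-1))).eq_zero_of_adjoin hσ hs hsign fun l hl => by
      rw [Pi.add_apply, Pi.smul_apply, h l hl, neg_one_smul, add_neg_cancel]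
  rwa [neg_one_smul, add_neg_eq_zero] at hzero

end Generators

section Contraction

variable {Ω : Type*} [Ring Ω] [Algebra ℝ Ω] {σ : Ω →ₐ[ℝ] Ω} {P : List Ω → Ω}

theorem IsFunction.apply_cons_cons (hσ : ∀ f, σ (σ f) = f) (hP : IsFunction σ P) (a f : Ω)
    (l : List Ω) :
    P (a :: f :: l) = P (evenPart σ f :: a :: l) + P (oddPart σ f :: σ a :: l) := by
  have hodd : P (a :: oddPart σ f :: l) = P (oddPart σ f :: σ a :: l) := by
    have hσa : σ a = evenPart σ a - oddPart σ a := by simp only [evenPart, oddPart]; module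
    have hsub : P (oddPart σ f :: σ a :: l)
        = P (oddPart σ f :: evenPart σ a :: l) - P (oddPart σ f :: oddPart σ a :: l) := by
      rw [hσa, sub_eq_add_neg, sub_eq_add_neg, ← neg_one_smul ℝ (oddPart σ a),
        ← neg_one_smul ℝ (P _)]
      exact (hP.map_add [oddPart σ f] l _ _).trans
        (congrArg _ (hP.map_smul [oddPart σ f] l (-1) _))
    have hadd : P (a :: oddPart σ f :: l)
        = P (evenPart σ a :: oddPart σ f :: l) + P (oddPart σ a :: oddPart σ f :: l) := by
      conv_lhs => rw [← evenPart_add_oddPart (σ := σ) a]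
      exact hP.map_add [] (oddPart σ f :: l) _ _
    rw [hsub, hadd, sub_eq_add_neg]
    exact congrArg₂ _ (hP.symm_even [] l _ _ (apply_evenPart hσ a))
      (hP.symm_odd [] l _ _ (apply_oddPart hσ a) (apply_oddPart hσ f))
  have hadd : P (a :: f :: l) = P (a :: evenPart σ f :: l) + P (a :: oddPart σ f :: l) := by
    conv_lhs => rw [← evenPart_add_oddPart (σ := σ) f]
    exact hP.map_add [a] l _ _
  rw [hadd, hodd]
  exact congrArg (· + _) (hP.symm_even [] l _ _ (apply_evenPart hσ f)).symm

theorem parity_rawForm (a : Ω) : parity σ (rawForm a) = rawForm (σ a) := by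
  funext l
  cases l with
  | nil => rfl
  | cons f l => exact map_zero σ

theorem rawBracket_rawForm (hσ : ∀ f, σ (σ f) = f) (hP : IsFunction σ P) (a : Ω) (l : List Ω) :
    rawBracket σ P (rawForm a) l = P (a :: l) := by
  induction l generalizing P a with
  | nil => simp only [rawBracket, rawForm, parity, List.map_cons, map_zero, add_zero, sub_zero]
  | cons f l ih =>
    have hzero : rawBracket σ P (contr (rawForm a) f) l = 0 := by
      have := rawBracket_smul_right (σ := σ) (Q := (0 : List Ω → Ω)) 0 l hP
      rwa [smul_zero, zero_smul] at this
    rw [rawBracket, hzero, parity_rawForm, ih (hP.contr _), ih (hP.contr _), zero_add,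
      hP.apply_cons_cons hσ]
    rfl

end Contraction

section Momentum

/-- `P` is homogeneous of degree `ε` in the momenta. Allowing `ε < 0`, where only `P = 0` qualifies,
lets contractions lower the degree without case distinctions. -/
def HasMomentum {Ω : Type*} [Zero Ω] (P : List Ω → Ω) (ε : ℤ) : Prop :=
  ∀ l : List Ω, (l.length : ℤ) ≠ ε → P l = 0

theorem HasMomentum.contr {Ω : Type*} [Ring Ω] {P : List Ω → Ω} {ε : ℤ} (hP : HasMomentum P ε)
    (f : Ω) : HasMomentum (contr P f) (ε - 1) :=
  fun l hl => hP (f :: l) (by rw [List.length_cons]; omega)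

variable {Ω : Type*} [Ring Ω] [Algebra ℝ Ω] {σ : Ω →ₐ[ℝ] Ω} {P Q : List Ω → Ω} {ε ε' : ℤ}

theorem HasMomentum.parity (hP : HasMomentum P ε) : HasMomentum (parity σ P) ε := fun l hl => by
  rw [SuperCotangent.parity, hP _ (by rwa [List.length_map]), map_zero]

theorem HasMomentum.rawBracket_nil (hPf : IsFunction σ P) (hQf : IsFunction σ Q)
    (hP : HasMomentum P ε) (hQ : HasMomentum Q ε') (h : ε + ε' ≠ 1) :
    rawBracket σ P Q [] = 0 := by
  have vanish {S T : List Ω → Ω} {m n : ℤ} (hS : HasMomentum S m) (hT : HasMomentum T n)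
      (hSf : IsFunction σ S) {g : Ω} (hg : T [] = 0 → g = 0) (hmn : m + n ≠ 1) : S [g] = 0 := by
    by_cases hn : n = 0
    · exact hS _ (by rw [List.length_singleton]; omega)
    · rw [hg (hT [] (by rw [List.length_nil]; omega)), hSf.apply_zero_cons]
  have heven : P [] = 0 → evenPart σ (P []) = 0 := fun h0 => by
    rw [evenPart, h0, map_zero, add_zero, smul_zero]
  rw [SuperCotangent.rawBracket, vanish hP hQ hPf id h, vanish hQ hP hQf heven (by omega)]
  by_cases hε : ε = 0
  · rw [hQ.parity _ (by rw [List.length_singleton]; omega), add_zero, sub_zero]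
  · rw [SuperCotangent.parity, hP [] (by rw [List.length_nil]; omega), oddPart, map_zero, sub_zero,
      smul_zero, List.map_singleton, map_zero, hQf.apply_zero_cons, map_zero, add_zero, sub_zero]

theorem HasMomentum.rawBracket (hσ : ∀ f, σ (σ f) = f) (hPf : IsFunction σ P)
    (hQf : IsFunction σ Q) (hP : HasMomentum P ε) (hQ : HasMomentum Q ε') :
    HasMomentum (rawBracket σ P Q) (ε + ε' - 1) := by
  intro l hl
  induction l generalizing P Q ε ε' with
  | nil => exact hP.rawBracket_nil hPf hQf hQ (by rw [List.length_nil] at hl; omega)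
  | cons f l ih =>
    rw [List.length_cons] at hl
    rw [SuperCotangent.rawBracket, ih hPf (hQf.contr f) hP (hQ.contr f) (by omega),
      ih (hPf.contr _) hQf (hP.contr _) hQ (by omega),
      ih (hPf.contr _) (hQf.parity hσ) (hP.contr _) hQ.parity (by omega), add_zero, add_zero]

end Momentum

section Degree

variable {R : Type*} [CommRing R] {L : Type*} [AddCommGroup L] [Module R L]

variable (R L) in
/-- The forms of degree `m`, with no non-zero ones if `m < 0`. Integer degrees avoid truncated
subtraction for operators that lower the degree. -/
noncomputable def formsDegree : ℤ → Submodule R (Forms R L)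
  | .ofNat k => ⋀[R]^k (Module.Dual R L)
  | .negSucc _ => ⊥

theorem mem_formsDegree_natCast {k : ℕ} {a : Forms R L} :
    a ∈ formsDegree R L k ↔ a ∈ ⋀[R]^k (Module.Dual R L) := Iff.rfl

theorem eq_zero_of_mem_formsDegree_neg {m : ℤ} (hm : m < 0) {a : Forms R L}
    (ha : a ∈ formsDegree R L m) : a = 0 := by
  cases m with
  | ofNat k => exact absurd hm (Int.natCast_nonneg k).not_gt
  | negSucc k => exact ha

theorem mul_mem_formsDegree {m n p : ℤ} {a b : Forms R L} (ha : a ∈ formsDegree R L m)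
    (hb : b ∈ formsDegree R L n) (hp : p = m + n) : a * b ∈ formsDegree R L p := by
  subst hp
  rcases lt_or_ge m 0 with hm | hm
  · rw [eq_zero_of_mem_formsDegree_neg hm ha, zero_mul]
    exact zero_mem _
  rcases lt_or_ge n 0 with hn | hn
  · rw [eq_zero_of_mem_formsDegree_neg hn hb, mul_zero]
    exact zero_mem _
  lift m to ℕ using hm
  lift n to ℕ using hn
  rw [← Nat.cast_add, mem_formsDegree_natCast]
  exact SetLike.mul_mem_graded (A := fun k : ℕ => ⋀[R]^k (Module.Dual R L)) ha hb

theorem fn_mem_formsDegree (f : R) : (fn f : Forms R L) ∈ formsDegree R L 0 :=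
  SetLike.algebraMap_mem_graded (fun k : ℕ => ⋀[R]^k (Module.Dual R L)) f

theorem cov_mem_formsDegree (α : Module.Dual R L) : cov α ∈ formsDegree R L 1 :=
  mem_formsDegree_natCast (k := 1).mpr (by simp)

theorem cov_mul_mem_formsDegree (α : Module.Dual R L) {m : ℤ} {a : Forms R L}
    (ha : a ∈ formsDegree R L m) : cov α * a ∈ formsDegree R L (m + 1) :=
  mul_mem_formsDegree (cov_mem_formsDegree α) ha (add_comm m 1)

theorem formsDegree_induction {p : ∀ (m : ℤ) (a : Forms R L), a ∈ formsDegree R L m → Prop}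
    (fn : ∀ f, p 0 (fn f) (fn_mem_formsDegree f)) (zero : ∀ m, p m 0 (zero_mem _))
    (add : ∀ m a b ha hb, p m a ha → p m b hb → p m (a + b) (add_mem ha hb))
    (cov_mul : ∀ α m a ha, p m a ha → p (m + 1) (cov α * a) (cov_mul_mem_formsDegree α ha))
    {m : ℤ} {a : Forms R L} (h : a ∈ formsDegree R L m) : p m a h := by
  cases m with
  | negSucc k =>
    obtain rfl := eq_zero_of_mem_formsDegree_neg (Int.negSucc_lt_zero k) h
    exact zero _
  | ofNat k =>
    induction h using Submodule.pow_induction_on_left' with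
    | algebraMap f => exact fn f
    | add a b k _ _ ha hb => exact add _ _ _ _ _ ha hb
    | mem_mul α hα k a ha ih =>
      obtain ⟨α, rfl⟩ := hα
      exact cov_mul α _ _ ha ih

theorem interior_mem_formsDegree (X : L) {m : ℤ} {a : Forms R L} (h : a ∈ formsDegree R L m) :
    interior X a ∈ formsDegree R L (m - 1) := by
  induction h using formsDegree_induction with
  | fn f =>
    rw [interior_fn]
    exact zero_mem _
  | zero m =>
    rw [map_zero]
    exact zero_mem _
  | add m a b _ _ ha hb =>
    rw [map_add]
    exact add_mem ha hb
  | cov_mul α m a ha ih =>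
    rw [interior_cov_mul, add_sub_cancel_right]
    refine sub_mem (Submodule.smul_mem _ _ ha) ?_
    rw [← sub_add_cancel m 1]
    exact cov_mul_mem_formsDegree α ih

theorem endDer_mem_formsDegree (N : L →ₗ[R] L) {m : ℤ} {a : Forms R L}
    (h : a ∈ formsDegree R L m) : endDer N a ∈ formsDegree R L m := by
  induction h using formsDegree_induction with
  | fn f =>
    rw [endDer_fn]
    exact zero_mem _
  | zero m =>
    rw [map_zero]
    exact zero_mem _
  | add m a b _ _ ha hb =>
    rw [map_add]
    exact add_mem ha hb
  | cov_mul α m a ha ih =>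
    rw [endDer_mul, endDer_cov]
    exact add_mem (cov_mul_mem_formsDegree _ ha) (cov_mul_mem_formsDegree _ ih)

variable [Algebra ℝ R] [Module ℝ L] [IsScalarTower ℝ R L]

theorem involution_of_mem_formsDegree {m : ℤ} {a : Forms R L} (h : a ∈ formsDegree R L m) :
    involution R L a = (-1 : ℝ) ^ m • a := by
  induction h using formsDegree_induction with
  | fn f => rw [involution_fn, zpow_zero, one_smul]
  | zero m => rw [map_zero, smul_zero]
  | add m a b _ _ ha hb => rw [map_add, ha, hb, smul_add]
  | cov_mul α m a ha ih =>
    rw [map_mul, ih, involution_cov, zpow_add_one₀ (by norm_num), mul_neg_one, neg_smul, neg_mul,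
      mul_smul_comm]

theorem neg_one_zpow_eq_or (m : ℤ) : (-1 : ℝ) ^ m = 1 ∨ (-1 : ℝ) ^ m = -1 :=
  (Int.even_or_odd m).imp Even.neg_one_zpow Odd.neg_one_zpow

theorem involution_eq_self_of_even {k : ℕ} {a : Forms R L} (ha : a ∈ ⋀[R]^k (Module.Dual R L))
    (hk : Even k) : involution R L a = a := by
  rw [involution_of_mem_formsDegree (mem_formsDegree_natCast.mpr ha), zpow_natCast,
    hk.neg_one_pow, one_smul]

theorem involution_eq_neg_of_odd {k : ℕ} {a : Forms R L} (ha : a ∈ ⋀[R]^k (Module.Dual R L))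
    (hk : Odd k) : involution R L a = -a := by
  rw [involution_of_mem_formsDegree (mem_formsDegree_natCast.mpr ha), zpow_natCast,
    hk.neg_one_pow, neg_one_smul]

theorem hasSign_of_mem_formsDegree {m : ℤ} {a : Forms R L} (h : a ∈ formsDegree R L m) :
    HasSign (involution R L) a ((-1) ^ m) :=
  ⟨neg_one_zpow_eq_or m, involution_of_mem_formsDegree h⟩

theorem involution_mem_formsDegree {m : ℤ} {a : Forms R L} (h : a ∈ formsDegree R L m) :
    involution R L a ∈ formsDegree R L m := by
  rw [involution_of_mem_formsDegree h]
  exact Submodule.smul_of_tower_mem _ _ h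

theorem evenPart_mem_formsDegree {m : ℤ} {a : Forms R L} (h : a ∈ formsDegree R L m) :
    evenPart (involution R L) a ∈ formsDegree R L m :=
  Submodule.smul_of_tower_mem _ _ (add_mem h (involution_mem_formsDegree h))

theorem oddPart_mem_formsDegree {m : ℤ} {a : Forms R L} (h : a ∈ formsDegree R L m) :
    oddPart (involution R L) a ∈ formsDegree R L m :=
  Submodule.smul_of_tower_mem _ _ (sub_mem h (involution_mem_formsDegree h))

end Degree

section Shift

variable {R : Type*} [CommRing R] {L : Type*} [AddCommGroup L] [Module R L]
  {P Q : List (Forms R L) → Forms R L} {e e' m : ℤ} {f : Forms R L} {k : ℕ}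

/-- `P` sends forms of degrees `k₁, …, kᵣ` to a form of degree `k₁ + … + kᵣ + e`. -/
def HasShift (P : List (Forms R L) → Forms R L) (e : ℤ) : Prop :=
  ∀ (l : List (Forms R L)) (k : List ℕ),
    List.Forall₂ (fun f i => f ∈ ⋀[R]^i (Module.Dual R L)) l k → P l ∈ formsDegree R L (k.sum + e)

theorem HasShift.apply_nil (hP : HasShift P e) : P [] ∈ formsDegree R L e := by
  simpa only [List.sum_nil, Nat.cast_zero, zero_add] using hP [] [] List.Forall₂.nil

theorem HasShift.contr (hP : HasShift P e) (hf : f ∈ formsDegree R L k) :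
    HasShift (contr P f) (e + k) := fun l ks h => by
  have := hP (f :: l) (k :: ks) (List.Forall₂.cons hf h)
  rwa [List.sum_cons, Nat.cast_add, add_comm (k : ℤ), add_assoc, add_comm (k : ℤ)] at this

theorem HasShift.apply_singleton [Algebra ℝ R] (hPf : IsFunction (involution R L) P)
    (hP : HasShift P e) (hf : f ∈ formsDegree R L m) : P [f] ∈ formsDegree R L (m + e) := by
  rcases lt_or_ge m 0 with hm | hm
  · rw [eq_zero_of_mem_formsDegree_neg hm hf, hPf.apply_zero_cons]
    exact zero_mem _
  · lift m to ℕ using hm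
    simpa only [List.sum_singleton] using hP [f] [m] (List.Forall₂.cons hf List.Forall₂.nil)

variable [Algebra ℝ R] [Module ℝ L] [IsScalarTower ℝ R L]

theorem HasShift.parity (hP : HasShift P e) : HasShift (parity (involution R L) P) e :=
  fun _ _ h => involution_mem_formsDegree <| hP _ _ <| List.forall₂_map_left_iff.mpr <|
    h.imp fun _ _ hf => mem_formsDegree_natCast.mp <|
      involution_mem_formsDegree (mem_formsDegree_natCast.mpr hf)

theorem HasShift.rawBracket (hPf : IsFunction (involution R L) P)
    (hQf : IsFunction (involution R L) Q) (hP : HasShift P e) (hQ : HasShift Q e') :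
    HasShift (rawBracket (involution R L) P Q) (e + e') := by
  intro l k h
  induction h generalizing P Q e e' with
  | nil =>
    have heven := hQ.apply_singleton hQf (evenPart_mem_formsDegree hP.apply_nil)
    have hodd := hQ.parity.apply_singleton (hQf.parity involution_involution)
      (oddPart_mem_formsDegree hP.apply_nil)
    have hmain := hP.apply_singleton hPf hQ.apply_nil
    rw [add_comm] at hmain
    rw [SuperCotangent.rawBracket, List.sum_nil, Nat.cast_zero, zero_add]
    exact sub_mem hmain (add_mem heven hodd)
  | @cons f i l k hf _ ih =>
    have hf : f ∈ formsDegree R L i := hf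
    have hright := ih hPf (hQf.contr f) hP (hQ.contr hf)
    have heven := ih (hPf.contr _) hQf (hP.contr (evenPart_mem_formsDegree hf)) hQ
    have hodd := ih (hPf.contr _) (hQf.parity involution_involution)
      (hP.contr (oddPart_mem_formsDegree hf)) hQ.parity
    have hdeg : ((i + k.sum : ℕ) : ℤ) + (e + e') = k.sum + (e + (e' + i)) := by push_cast; ring
    have hdeg' : (k.sum : ℤ) + (e + i + e') = k.sum + (e + (e' + i)) := by ring
    rw [hdeg'] at heven hodd
    rw [SuperCotangent.rawBracket, List.sum_cons, hdeg]
    exact add_mem (add_mem hright heven) hodd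

end Shift

section Bidegree

variable {R : Type*} [CommRing R] {L : Type*} [AddCommGroup L] [Module R L]
  {P Q : List (Forms R L) → Forms R L}

theorem hasBidegree_iff {ε δ : ℕ} :
    HasBidegree P ε δ ↔ HasMomentum P ε ∧ HasShift P (δ - ε) := by
  refine and_congr (by simp only [HasMomentum, ne_eq, Nat.cast_inj])
    (forall₂_congr fun l k => imp_congr_right fun _ => ?_)
  constructor
  · rintro ⟨hmem, hzero⟩
    rcases lt_or_ge (k.sum + δ) ε with h | h
    · rw [hzero h]
      exact zero_mem _
    · have hdeg : (k.sum : ℤ) + (δ - ε) = (k.sum + δ - ε : ℕ) := by omega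
      rw [hdeg]
      exact hmem _ (Nat.sub_add_cancel h)
  · intro h
    refine ⟨fun m hm => ?_, fun hlt => eq_zero_of_mem_formsDegree_neg (by omega) h⟩
    have hdeg : (k.sum : ℤ) + (δ - ε) = m := by omega
    rwa [hdeg] at h

/-- `a` is a function or a one-form. -/
def IsGenerator (a : Forms R L) : Prop := (∃ f, a = fn f) ∨ ∃ α, a = cov α

theorem IsGenerator.exists_mem_formsDegree {a : Forms R L} (ha : IsGenerator a) :
    ∃ k : ℕ, a ∈ formsDegree R L k := by
  obtain ⟨f, rfl⟩ | ⟨α, rfl⟩ := ha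
  · exact ⟨0, fn_mem_formsDegree f⟩
  · exact ⟨1, cov_mem_formsDegree α⟩

theorem adjoin_isGenerator [Algebra ℝ R] :
    Algebra.adjoin ℝ {a : Forms R L | IsGenerator a} = ⊤ := by
  refine eq_top_iff.mpr fun a _ => ?_
  induction a using forms_induction with
  | hf f => exact Algebra.subset_adjoin (Or.inl ⟨f, rfl⟩)
  | hc α => exact Algebra.subset_adjoin (Or.inr ⟨α, rfl⟩)
  | hm a b ha hb => exact mul_mem (ha trivial) (hb trivial)
  | ha a b ha hb => exact add_mem (ha trivial) (hb trivial)

variable [Algebra ℝ R] [Module ℝ L] [IsScalarTower ℝ R L]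

theorem IsFunction.ext_isGenerator (hP : IsFunction (involution R L) P)
    (hQ : IsFunction (involution R L) Q)
    (h : ∀ l : List (Forms R L), (∀ a ∈ l, IsGenerator a) → P l = Q l) : P = Q := by
  refine hP.ext_of_adjoin involution_involution hQ adjoin_isGenerator (fun a ha => ?_) h
  obtain ⟨k, hk⟩ := IsGenerator.exists_mem_formsDegree ha
  exact ⟨_, hasSign_of_mem_formsDegree hk⟩

theorem HasShift.parity_apply {e : ℤ} (hPf : IsFunction (involution R L) P) (hP : HasShift P e)
    {l : List (Forms R L)} (hl : ∀ a ∈ l, IsGenerator a) :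
    SuperCotangent.parity (involution R L) P l = (-1 : ℝ) ^ e • P l := by
  induction l generalizing P e with
  | nil => exact involution_of_mem_formsDegree hP.apply_nil
  | cons a l ih =>
    rw [List.forall_mem_cons] at hl
    obtain ⟨k, ha⟩ := hl.1.exists_mem_formsDegree
    calc SuperCotangent.parity (involution R L) P (a :: l)
        = SuperCotangent.parity (involution R L)
            (SuperCotangent.contr P (involution R L a)) l :=
          congrFun (contr_parity involution_involution P a) l
      _ = (-1 : ℝ) ^ (k : ℤ) • (-1 : ℝ) ^ (e + k) • P (a :: l) := by
          rw [involution_of_mem_formsDegree ha, hPf.contr_smul, parity_smul, Pi.smul_apply,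
            ih (hPf.contr a) (hP.contr ha) hl.2]
          rfl
      _ = (-1 : ℝ) ^ e • P (a :: l) := by
          rw [smul_smul, ← zpow_add₀ (by norm_num), add_left_comm, zpow_add₀ (by norm_num),
            (Even.add_self (k : ℤ)).neg_one_zpow, mul_one]

theorem HasBidegree.hasParity {ε δ : ℕ} (hPf : IsFunction (involution R L) P)
    (hP : HasBidegree P ε δ) : HasParity (involution R L) P ((-1) ^ ((δ : ℤ) - ε)) :=
  ⟨hPf, neg_one_zpow_eq_or _, (hPf.parity involution_involution).ext_isGenerator (hPf.smul _)
    fun _ hl => (hasBidegree_iff.mp hP).2.parity_apply hPf hl⟩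

end Bidegree

section BigBracket

variable {R : Type*} [CommRing R] [Algebra ℝ R] {L : Type*} [AddCommGroup L] [Module R L]

theorem CotangentFunctions.add_apply (P Q : CotangentFunctions R L) (l : List (Forms R L)) :
    (P + Q) l = P l + Q l := rfl

theorem CotangentFunctions.neg_apply (P : CotangentFunctions R L) (l : List (Forms R L)) :
    (-P) l = -P l := rfl

theorem ofForm_add (a b : Forms R L) : ofForm (a + b) = ofForm a + ofForm b :=
  Subtype.ext <| funext fun l => by
    cases l with
    | nil => rfl
    | cons f l => exact (add_zero 0).symm

theorem ofForm_smul (c : ℝ) (a : Forms R L) : ofForm (c • a) = c • ofForm a :=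
  Subtype.ext <| funext fun l => by
    cases l with
    | nil => rfl
    | cons f l => exact (smul_zero c).symm

theorem ofForm_neg (a : Forms R L) : ofForm (-a) = -ofForm a :=
  map_neg (AddMonoidHom.mk' ofForm ofForm_add) a

theorem HasBidegree.add {P Q : CotangentFunctions R L} {ε δ : ℕ}
    (hP : HasBidegree P ε δ) (hQ : HasBidegree Q ε δ) :
    HasBidegree (P + Q : CotangentFunctions R L) ε δ := by
  rw [hasBidegree_iff] at *
  refine ⟨fun l hl => ?_, fun l k h => add_mem (hP.2 l k h) (hQ.2 l k h)⟩
  rw [CotangentFunctions.add_apply, hP.1 l hl, hQ.1 l hl, add_zero]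

theorem HasBidegree.neg {P : CotangentFunctions R L} {ε δ : ℕ} (hP : HasBidegree P ε δ) :
    HasBidegree (-P : CotangentFunctions R L) ε δ := by
  rw [hasBidegree_iff] at *
  refine ⟨fun l hl => ?_, fun l k h => neg_mem (hP.2 l k h)⟩
  rw [CotangentFunctions.neg_apply, hP.1 l hl, neg_zero]

theorem HasBidegree.hasMomentum {P : CotangentFunctions R L} {ε δ : ℕ}
    (hP : HasBidegree P ε δ) : HasMomentum P ε :=
  (hasBidegree_iff.mp hP).1

theorem HasBidegree.hasShift {P : CotangentFunctions R L} {ε δ : ℕ}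
    (hP : HasBidegree P ε δ) : HasShift P (δ - ε) :=
  (hasBidegree_iff.mp hP).2

theorem HasBidegree.apply_fn_fn {P : CotangentFunctions R L} (hP : HasBidegree P 2 1) (f g : R) :
    P [fn f, fn g] = 0 := by
  have hdeg : P [fn f, fn g] ∈ formsDegree R L (-1) :=
    hP.hasShift [fn f, fn g] [0, 0]
      (.cons (fn_mem_formsDegree f) (.cons (fn_mem_formsDegree g) .nil))
  exact eq_zero_of_mem_formsDegree_neg (by norm_num) hdeg

theorem hasBidegree_ofForm {a : Forms R L} {k : ℕ} (ha : a ∈ ⋀[R]^k (Module.Dual R L)) :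
    HasBidegree (ofForm a) 0 k := by
  refine hasBidegree_iff.mpr ⟨fun l hl => ?_, ?_⟩
  · cases l with
    | nil => exact absurd rfl hl
    | cons f l => rfl
  · rintro _ _ (_ | ⟨_, _⟩)
    · rw [List.sum_nil, Nat.cast_zero, zero_add, sub_zero]
      exact ha
    · exact zero_mem _

variable [Module ℝ L] [IsScalarTower ℝ R L] {P Q T : CotangentFunctions R L} {s t u : ℝ}

theorem bracket_add_right (P Q T : CotangentFunctions R L) : ⁅P, Q + T⁆ = ⁅P, Q⁆ + ⁅P, T⁆ :=
  Subtype.ext <| funext fun l => rawBracket_add_right l P.2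

theorem bracket_add_left (P Q T : CotangentFunctions R L) : ⁅P + Q, T⁆ = ⁅P, T⁆ + ⁅Q, T⁆ :=
  Subtype.ext <| funext fun l => rawBracket_add_left involution_involution l T.2

theorem bracket_smul_right (c : ℝ) (P Q : CotangentFunctions R L) : ⁅P, c • Q⁆ = c • ⁅P, Q⁆ :=
  Subtype.ext <| funext fun l => rawBracket_smul_right c l P.2

theorem bracket_smul_left (c : ℝ) (P Q : CotangentFunctions R L) : ⁅c • P, Q⁆ = c • ⁅P, Q⁆ :=
  Subtype.ext <| funext fun l => rawBracket_smul_left involution_involution c l Q.2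

/-- The big bracket as a bilinear map. -/
noncomputable def bracketₗ :
    CotangentFunctions R L →ₗ[ℝ] CotangentFunctions R L →ₗ[ℝ] CotangentFunctions R L :=
  LinearMap.mk₂ ℝ (fun P Q => ⁅P, Q⁆) bracket_add_left bracket_smul_left bracket_add_right
    bracket_smul_right

theorem bracket_neg_right (P Q : CotangentFunctions R L) : ⁅P, -Q⁆ = -⁅P, Q⁆ :=
  map_neg (bracketₗ P) Q

theorem bracket_neg_left (P Q : CotangentFunctions R L) : ⁅-P, Q⁆ = -⁅P, Q⁆ :=
  map_neg (bracketₗ.flip Q) P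

theorem bracket_zero_right (P : CotangentFunctions R L) :
    ⁅P, (0 : CotangentFunctions R L)⁆ = 0 :=
  map_zero (bracketₗ P)

theorem bracket_zero_left (P : CotangentFunctions R L) :
    ⁅(0 : CotangentFunctions R L), P⁆ = 0 :=
  map_zero (bracketₗ.flip P)

theorem sum_bracket {ι : Type*} (s : Finset ι) (P : ι → CotangentFunctions R L)
    (Q : CotangentFunctions R L) : ⁅∑ i ∈ s, P i, Q⁆ = ∑ i ∈ s, ⁅P i, Q⁆ :=
  map_sum (bracketₗ.flip Q) P s

theorem bracket_sum {ι : Type*} (s : Finset ι) (P : CotangentFunctions R L)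
    (Q : ι → CotangentFunctions R L) : ⁅P, ∑ i ∈ s, Q i⁆ = ∑ i ∈ s, ⁅P, Q i⁆ :=
  map_sum (bracketₗ P) Q s

theorem bracket_swap (hP : HasParity (involution R L) P s) (hQ : HasParity (involution R L) Q t) :
    ⁅P, Q⁆ = -(koszulSign s t • ⁅Q, P⁆) :=
  Subtype.ext <| funext fun l => rawBracket_swap involution_involution hP hQ l

theorem exists_hasParity_add (P : CotangentFunctions R L) :
    ∃ P₀ P₁ : CotangentFunctions R L, HasParity (involution R L) P₀ 1 ∧
      HasParity (involution R L) P₁ (-1) ∧ P = P₀ + P₁ := by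
  obtain ⟨P₀, P₁, h₀, h₁, hP⟩ := P.2.exists_hasParity_add involution_involution
  exact ⟨⟨P₀, h₀.isFunction⟩, ⟨P₁, h₁.isFunction⟩, h₀, h₁, Subtype.ext hP⟩

theorem bracket_swap_even (P : CotangentFunctions R L) (hT : HasParity (involution R L) T 1) :
    ⁅P, T⁆ = -⁅T, P⁆ := by
  obtain ⟨P₀, P₁, h₀, h₁, rfl⟩ := exists_hasParity_add P
  rw [bracket_add_left, bracket_add_right, bracket_swap h₀ hT, bracket_swap h₁ hT,
    koszulSign_one_right, koszulSign_one_right, one_smul, one_smul, neg_add]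

theorem bracket_swap_odd (hP : HasParity (involution R L) P (-1))
    (hQ : HasParity (involution R L) Q (-1)) : ⁅P, Q⁆ = ⁅Q, P⁆ := by
  rw [bracket_swap hP hQ, koszulSign_neg_one_neg_one]
  module

theorem bracket_bracket (hP : HasParity (involution R L) P s)
    (hQ : HasParity (involution R L) Q t) (hT : HasParity (involution R L) T u) :
    ⁅⁅P, Q⁆, T⁆ = ⁅P, ⁅Q, T⁆⁆ + koszulSign t u • ⁅⁅P, T⁆, Q⁆ :=
  Subtype.ext <| funext fun l => rawBracket_jacobi involution_involution hP hQ hT l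

theorem bracket_bracket_even (P Q : CotangentFunctions R L)
    (hT : HasParity (involution R L) T 1) : ⁅⁅P, Q⁆, T⁆ = ⁅P, ⁅Q, T⁆⁆ + ⁅⁅P, T⁆, Q⁆ := by
  have homogeneous {S U : CotangentFunctions R L} {s u : ℝ}
      (hS : HasParity (involution R L) S s) (hU : HasParity (involution R L) U u) :
      ⁅⁅S, U⁆, T⁆ = ⁅S, ⁅U, T⁆⁆ + ⁅⁅S, T⁆, U⁆ := by
    rw [bracket_bracket hS hU hT, koszulSign_one_right, one_smul]
  obtain ⟨P₀, P₁, hP₀, hP₁, rfl⟩ := exists_hasParity_add P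
  obtain ⟨Q₀, Q₁, hQ₀, hQ₁, rfl⟩ := exists_hasParity_add Q
  simp only [bracket_add_left, bracket_add_right, homogeneous hP₀ hQ₀, homogeneous hP₀ hQ₁,
    homogeneous hP₁ hQ₀, homogeneous hP₁ hQ₁]
  abel

theorem bracket_even_bracket (hT : HasParity (involution R L) T 1)
    (P Q : CotangentFunctions R L) : ⁅⁅T, P⁆, Q⁆ = ⁅T, ⁅P, Q⁆⁆ - ⁅P, ⁅T, Q⁆⁆ := by
  have h := bracket_bracket_even P Q hT
  rw [bracket_swap_even _ hT, bracket_swap_even Q hT, bracket_swap_even P hT, bracket_neg_right,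
    bracket_neg_left] at h
  rw [← neg_neg ⁅T, ⁅P, Q⁆⁆, h]
  abel

theorem HasParity.bracket (hP : HasParity (involution R L) P s)
    (hQ : HasParity (involution R L) Q t) :
    HasParity (involution R L) (⁅P, Q⁆ : CotangentFunctions R L) (s * t) :=
  hP.rawBracket involution_involution hQ

theorem HasBidegree.bracket {ε δ ε' δ' ε'' δ'' : ℕ} (hP : HasBidegree P ε δ)
    (hQ : HasBidegree Q ε' δ') (hε : ε'' + 1 = ε + ε') (hδ : δ'' + 1 = δ + δ') :
    HasBidegree (⁅P, Q⁆ : CotangentFunctions R L) ε'' δ'' := by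
  obtain ⟨hP, hP'⟩ := hasBidegree_iff.mp hP
  obtain ⟨hQ, hQ'⟩ := hasBidegree_iff.mp hQ
  have momentum := hP.rawBracket involution_involution P.2 Q.2 hQ
  have shift := hP'.rawBracket P.2 Q.2 hQ'
  rw [show (ε : ℤ) + ε' - 1 = ε'' by omega] at momentum
  rw [show (δ : ℤ) - ε + (δ' - ε') = δ'' - ε'' by omega] at shift
  exact hasBidegree_iff.mpr ⟨momentum, shift⟩

end BigBracket

section Evaluation

variable {R : Type*} [CommRing R] [Algebra ℝ R] {L : Type*} [AddCommGroup L] [Module R L]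

theorem eq_ofForm_of_hasMomentum_zero {P : CotangentFunctions R L} (hP : HasMomentum P 0) :
    P = ofForm (P []) :=
  Subtype.ext <| funext fun l => by
    cases l with
    | nil => rfl
    | cons f l => exact hP (f :: l) (by rw [List.length_cons]; omega)

theorem hasParity_ofForm {a : Forms R L} {s : ℝ} (ha : HasSign (involution R L) a s) :
    HasParity (involution R L) (ofForm a) s := by
  refine ⟨(ofForm a).2, ha.sign, (parity_rawForm a).trans ?_⟩
  rw [ha.apply_eq]
  exact congrArg Subtype.val (ofForm_smul s a)

variable [Module ℝ L] [IsScalarTower ℝ R L] {P Q : CotangentFunctions R L} {s t u : ℝ}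
  {a b c : Forms R L}

theorem bracket_ofForm_apply (P : CotangentFunctions R L) (a : Forms R L)
    (l : List (Forms R L)) : ⁅P, ofForm a⁆ l = P (a :: l) :=
  rawBracket_rawForm involution_involution P.2 a l

theorem bracket_ofForm_ofForm (a b : Forms R L) : ⁅ofForm a, ofForm b⁆ = 0 :=
  Subtype.ext <| funext fun l => bracket_ofForm_apply (ofForm a) b l

theorem HasMomentum.bracket_ofForm {ε : ℤ} (hP : HasMomentum P ε) (a : Forms R L) :
    HasMomentum (⁅P, ofForm a⁆ : CotangentFunctions R L) (ε - 1) := fun l hl => by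
  rw [bracket_ofForm_apply]
  exact hP.contr a l hl

theorem bracket_ofForm_of_hasMomentum_one (hP : HasMomentum P 1) (a : Forms R L) :
    ⁅P, ofForm a⁆ = ofForm (P [a]) := by
  rw [eq_ofForm_of_hasMomentum_zero (hP.bracket_ofForm a), bracket_ofForm_apply]

theorem bracket_bracket_ofForm_of_hasMomentum_two (hP : HasMomentum P 2) (a b : Forms R L) :
    ⁅⁅P, ofForm a⁆, ofForm b⁆ = ofForm (P [a, b]) := by
  rw [bracket_ofForm_of_hasMomentum_one (hP.bracket_ofForm a), bracket_ofForm_apply]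

theorem bracket_singleton_of_hasMomentum_one (hP : HasParity (involution R L) P s)
    (hQ : HasParity (involution R L) Q t) (hP₁ : HasMomentum P 1) (hQ₁ : HasMomentum Q 1)
    (ha : HasSign (involution R L) a u) :
    ⁅P, Q⁆ [a] = P [Q [a]] - koszulSign s t • Q [P [a]] := by
  have hPa : HasParity (involution R L) (ofForm (P [a])) (s * u) := by
    rw [← bracket_ofForm_of_hasMomentum_one hP₁]
    exact hP.bracket (hasParity_ofForm ha)
  have h := bracket_bracket hP hQ (hasParity_ofForm ha)
  rw [bracket_ofForm_of_hasMomentum_one hQ₁, bracket_ofForm_of_hasMomentum_one hP₁,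
    bracket_ofForm_of_hasMomentum_one hP₁, bracket_swap hPa hQ,
    bracket_ofForm_of_hasMomentum_one hQ₁] at h
  have hsign : koszulSign t u * koszulSign (s * u) t = koszulSign s t := by
    rcases hP.sign with rfl | rfl <;> rcases hQ.sign with rfl | rfl <;>
      rcases ha.sign with rfl | rfl <;> norm_num [koszulSign]
  rw [← bracket_ofForm_apply, h, ← hsign, mul_smul, smul_neg, ← sub_eq_add_neg]
  rfl

theorem HasParity.bracket_ofForm (hP : HasParity (involution R L) P s)
    (ha : HasSign (involution R L) a (-1)) :
    HasParity (involution R L) (⁅P, ofForm a⁆ : CotangentFunctions R L) (-s) := by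
  simpa only [mul_neg_one] using hP.bracket (hasParity_ofForm ha)

theorem HasParity.hasSign_apply_pair (hP : HasParity (involution R L) P s) (hP₂ : HasMomentum P 2)
    (ha : HasSign (involution R L) a (-1)) (hb : HasSign (involution R L) b (-1)) :
    HasSign (involution R L) (P [a, b]) s := by
  have h := (hP.bracket_ofForm ha).bracket_ofForm hb
  rw [bracket_bracket_ofForm_of_hasMomentum_two hP₂, neg_neg] at h
  exact h.apply_nil

theorem bracket_bracket_bracket_ofForm (hP : HasParity (involution R L) P (-1))
    (hQ : HasParity (involution R L) Q 1) (hP₂ : HasMomentum P 2) (hQ₂ : HasMomentum Q 2)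
    (ha : HasSign (involution R L) a (-1)) (hb : HasSign (involution R L) b (-1)) :
    ⁅⁅⁅P, Q⁆, ofForm a⁆, ofForm b⁆
      = ⁅P, ofForm (Q [a, b])⁆ - ⁅⁅P, ofForm b⁆, ⁅Q, ofForm a⁆⁆
        + (⁅⁅P, ofForm a⁆, ⁅Q, ofForm b⁆⁆ - ⁅Q, ofForm (P [a, b])⁆) := by
  have hPab := hasParity_ofForm (hP.hasSign_apply_pair hP₂ ha hb)
  rw [bracket_bracket hP hQ (hasParity_ofForm ha), bracket_add_left, bracket_smul_left,
    bracket_bracket hP (hQ.bracket_ofForm ha) (hasParity_ofForm hb),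
    bracket_bracket (hP.bracket_ofForm ha) hQ (hasParity_ofForm hb),
    bracket_bracket_ofForm_of_hasMomentum_two hQ₂, bracket_bracket_ofForm_of_hasMomentum_two hP₂,
    bracket_swap hPab hQ, koszulSign_one_left, koszulSign_one_right, koszulSign_neg_one_neg_one]
  module

theorem bracket_triple_of_hasMomentum_two (hP : HasParity (involution R L) P (-1))
    (hQ : HasParity (involution R L) Q 1) (hP₂ : HasMomentum P 2) (hQ₂ : HasMomentum Q 2)
    (ha : HasSign (involution R L) a (-1)) (hb : HasSign (involution R L) b (-1))
    (hc : HasSign (involution R L) c (-1)) :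
    ⁅P, Q⁆ [a, b, c] = P [a, Q [b, c]] - P [b, Q [a, c]] + P [c, Q [a, b]]
      + (Q [a, P [b, c]] - Q [b, P [a, c]] + Q [c, P [a, b]]) := by
  have mixed {x y : Forms R L} (hx : HasSign (involution R L) x (-1))
      (hy : HasSign (involution R L) y (-1)) :
      ⁅⁅P, ofForm x⁆, ⁅Q, ofForm y⁆⁆ [c] = P [x, Q [y, c]] - Q [y, P [x, c]] := by
    rw [bracket_singleton_of_hasMomentum_one (hP.bracket_ofForm hx) (hQ.bracket_ofForm hy)
      (hP₂.bracket_ofForm x) (hQ₂.bracket_ofForm y) hc, neg_neg, koszulSign_one_left, one_smul]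
    simp only [bracket_ofForm_apply]
  have hP_swap : P [Q [a, b], c] = P [c, Q [a, b]] := by
    rw [P.2.apply_pair_swap (hQ.hasSign_apply_pair hQ₂ ha hb) hc, koszulSign_one_left, one_smul]
  have hQ_swap : Q [P [a, b], c] = -Q [c, P [a, b]] := by
    rw [Q.2.apply_pair_swap (hP.hasSign_apply_pair hP₂ ha hb) hc, koszulSign_neg_one_neg_one,
      neg_one_smul]
  have h := congrArg (fun T : CotangentFunctions R L => T [c])
    (bracket_bracket_bracket_ofForm hP hQ hP₂ hQ₂ ha hb)
  simp only [sub_eq_add_neg, CotangentFunctions.add_apply, CotangentFunctions.neg_apply,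
    bracket_ofForm_apply, mixed ha hb, mixed hb ha, hP_swap, hQ_swap] at h
  rw [h]
  abel

end Evaluation

section Extensionality

variable {R : Type*} [CommRing R] [Algebra ℝ R] {L : Type*} [AddCommGroup L] [Module R L]
  [Module ℝ L] [IsScalarTower ℝ R L] {P Q : CotangentFunctions R L} {ε δ : ℕ}

theorem HasBidegree.hasParity_of_even (hP : HasBidegree P ε δ) (h : Even (δ + ε)) :
    HasParity (involution R L) P 1 := by
  have heven : Even ((δ : ℤ) - ε) := by
    rwa [Int.even_sub, Int.even_coe_nat, Int.even_coe_nat, ← Nat.even_add]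
  simpa only [heven.neg_one_zpow] using hP.hasParity P.2

theorem HasBidegree.hasParity_of_odd (hP : HasBidegree P ε δ) (h : Odd (δ + ε)) :
    HasParity (involution R L) P (-1) := by
  have hodd : Odd ((δ : ℤ) - ε) := by
    rwa [Int.odd_sub, Int.odd_coe_nat, Int.even_coe_nat, ← Nat.odd_add]
  simpa only [hodd.neg_one_zpow] using hP.hasParity P.2

theorem CotangentFunctions.ext_isGenerator
    (h : ∀ l : List (Forms R L), (∀ a ∈ l, IsGenerator a) → P l = Q l) : P = Q :=
  Subtype.ext <| P.2.ext_isGenerator Q.2 h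

theorem ext_of_hasBidegree_one (hP : HasBidegree P 1 δ) (hQ : HasBidegree Q 1 δ)
    (hfn : ∀ f : R, P [fn f] = Q [fn f])
    (hcov : ∀ α : Module.Dual R L, P [cov α] = Q [cov α]) : P = Q := by
  refine CotangentFunctions.ext_isGenerator fun l hl => ?_
  by_cases hlen : l.length = 1
  · obtain ⟨a, rfl⟩ := List.length_eq_one_iff.mp hlen
    obtain ⟨f, rfl⟩ | ⟨α, rfl⟩ := hl a (List.mem_singleton_self a)
    exacts [hfn f, hcov α]
  · rw [hP.1 l hlen, hQ.1 l hlen]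

theorem ext_of_hasBidegree_two_one (hP : HasBidegree P 2 1) (hQ : HasBidegree Q 2 1)
    (hcov_fn : ∀ (α : Module.Dual R L) (f : R), P [cov α, fn f] = Q [cov α, fn f])
    (hcov_cov : ∀ α β : Module.Dual R L, P [cov α, cov β] = Q [cov α, cov β]) : P = Q := by
  refine CotangentFunctions.ext_isGenerator fun l hl => ?_
  by_cases hlen : l.length = 2
  · obtain ⟨a, b, rfl⟩ := List.length_eq_two.mp hlen
    simp only [List.forall_mem_cons] at hl
    obtain ⟨⟨f, rfl⟩ | ⟨α, rfl⟩, ⟨g, rfl⟩ | ⟨β, rfl⟩, -⟩ := hl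
    · rw [hP.apply_fn_fn, hQ.apply_fn_fn]
    · exact (P.2.symm_even [] [] (fn f) (cov β) (involution_fn f)).trans <| (hcov_fn β f).trans
        (Q.2.symm_even [] [] (fn f) (cov β) (involution_fn f)).symm
    · exact hcov_fn α g
    · exact hcov_cov α β
  · rw [hP.1 l hlen, hQ.1 l hlen]

theorem eq_zero_of_hasBidegree_three_zero (hP : HasBidegree P 3 0)
    (h : ∀ α β γ : Module.Dual R L, P [cov α, cov β, cov γ] = 0) : P = 0 := by
  have degree {a : Forms R L} (ha : IsGenerator a) :
      ∃ k ≤ 1, a ∈ ⋀[R]^k (Module.Dual R L) ∧ (k = 1 → ∃ α, a = cov α) := by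
    obtain ⟨f, rfl⟩ | ⟨α, rfl⟩ := ha
    · exact ⟨0, zero_le_one, fn_mem_formsDegree f, fun h => absurd h zero_ne_one⟩
    · exact ⟨1, le_rfl, cov_mem_formsDegree α, fun _ => ⟨α, rfl⟩⟩
  refine CotangentFunctions.ext_isGenerator fun l hl => ?_
  by_cases hlen : l.length = 3
  · obtain ⟨a, b, c, rfl⟩ := List.length_eq_three.mp hlen
    simp only [List.forall_mem_cons] at hl
    obtain ⟨i, hi, hai, ha⟩ := degree hl.1
    obtain ⟨j, hj, hbj, hb⟩ := degree hl.2.1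
    obtain ⟨k, hk, hck, hc⟩ := degree hl.2.2.1
    have hsum : [i, j, k].sum = i + j + k := by simp only [List.sum_cons, List.sum_nil]; ring
    rcases (show i + j + k ≤ 3 by omega).lt_or_eq with hlt | heq
    · exact (hP.2 [a, b, c] [i, j, k] (.cons hai (.cons hbj (.cons hck .nil)))).2 (by omega)
    · obtain ⟨α, rfl⟩ := ha (by omega)
      obtain ⟨β, rfl⟩ := hb (by omega)
      obtain ⟨γ, rfl⟩ := hc (by omega)
      exact h α β γ
  · exact hP.1 l hlen

end Extensionality

section Tensors

variable {R : Type*} [CommRing R] [Algebra ℝ R] {L : Type*} [AddCommGroup L] [Module R L]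
  [Module ℝ L] [IsScalarTower ℝ R L]

theorem bivectorPairing_fn_left (π : ⋀[R]^2 L) (f : R) (a : Forms R L) :
    bivectorPairing π (fn f) a = 0 := by
  induction π using wedge_induction with
  | hw X Y =>
    simp only [bivectorPairing_wedge, involution_fn, interior_fn, zero_mul, sub_zero]
  | h0 => rw [map_zero, LinearMap.zero_apply, LinearMap.zero_apply]
  | ha x y hx hy => rw [map_add, LinearMap.add_apply, LinearMap.add_apply, hx, hy, add_zero]
  | hs c x hx => rw [map_smul, LinearMap.smul_apply, LinearMap.smul_apply, hx, smul_zero]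

theorem bivectorPairing_fn_right (π : ⋀[R]^2 L) (f : R) (a : Forms R L) :
    bivectorPairing π a (fn f) = 0 := by
  rw [← bivectorPairing_symm_even π _ _ (involution_fn f), bivectorPairing_fn_left]

theorem bivectorPairing_cov_left (π : ⋀[R]^2 L) (α : Module.Dual R L) (a : Forms R L) :
    bivectorPairing π (cov α) a = -interior (sharp π α) a := by
  induction π using wedge_induction with
  | hw X Y =>
    simp only [bivectorPairing_wedge, involution_cov, sharp_wedge, map_neg, interior_cov, map_sub,
      map_smul, neg_mul, ← Algebra.smul_def, LinearMap.sub_apply, LinearMap.smul_apply]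
    abel
  | h0 => simp only [map_zero, LinearMap.zero_apply, neg_zero]
  | ha x y hx hy => simp only [map_add, LinearMap.add_apply, hx, hy, neg_add]
  | hs c x hx => simp only [map_smul, LinearMap.smul_apply, hx, smul_neg]

theorem bivectorPairing_mem_formsDegree (π : ⋀[R]^2 L) {m n : ℤ} {a b : Forms R L}
    (ha : a ∈ formsDegree R L m) (hb : b ∈ formsDegree R L n) :
    bivectorPairing π a b ∈ formsDegree R L (m + n - 2) := by
  have interior_mul_interior (X Y : L) :
      interior X (involution R L a) * interior Y b ∈ formsDegree R L (m + n - 2) :=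
    mul_mem_formsDegree (interior_mem_formsDegree X (involution_mem_formsDegree ha))
      (interior_mem_formsDegree Y hb) (by ring)
  induction π using wedge_induction with
  | hw X Y =>
    rw [bivectorPairing_wedge]
    exact sub_mem (interior_mul_interior X Y) (interior_mul_interior Y X)
  | h0 => rw [map_zero]; exact zero_mem _
  | ha x y hx hy => rw [map_add]; exact add_mem hx hy
  | hs c x hx => rw [map_smul]; exact Submodule.smul_mem _ _ hx

theorem hasBidegree_ofEnd (N : L →ₗ[R] L) : HasBidegree (ofEnd N) 1 1 := by
  refine hasBidegree_iff.mpr ⟨fun l hl => ?_, ?_⟩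
  · rcases l with _ | ⟨a, _ | ⟨b, l⟩⟩
    exacts [rfl, absurd rfl hl, rfl]
  · rintro _ _ (_ | ⟨ha, _ | ⟨_, _⟩⟩)
    · exact zero_mem _
    · rw [List.sum_singleton, sub_self, add_zero]
      exact endDer_mem_formsDegree N ha
    · exact zero_mem _

theorem hasBidegree_ofBivector (π : ⋀[R]^2 L) : HasBidegree (ofBivector π) 2 0 := by
  refine hasBidegree_iff.mpr ⟨fun l hl => ?_, ?_⟩
  · rcases l with _ | ⟨a, _ | ⟨b, _ | ⟨c, l⟩⟩⟩
    exacts [rfl, rfl, absurd rfl hl, rfl]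
  · rintro _ _ (_ | ⟨ha, _ | ⟨hb, _ | ⟨_, _⟩⟩⟩)
    · exact zero_mem _
    · exact zero_mem _
    · rw [List.sum_cons, List.sum_singleton, Nat.cast_add, Nat.cast_zero, zero_sub,
        ← sub_eq_add_neg]
      exact bivectorPairing_mem_formsDegree π ha hb
    · exact zero_mem _

theorem hasParity_ofEnd (N : L →ₗ[R] L) : HasParity (involution R L) (ofEnd N) 1 :=
  (hasBidegree_ofEnd N).hasParity_of_even even_two

theorem hasParity_ofBivector (π : ⋀[R]^2 L) : HasParity (involution R L) (ofBivector π) 1 :=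
  (hasBidegree_ofBivector π).hasParity_of_even even_two

theorem ofBivector_add (π π' : ⋀[R]^2 L) :
    ofBivector (π + π') = ofBivector π + ofBivector π' := by
  refine Subtype.ext <| funext fun l => ?_
  by_cases hlen : l.length = 2
  · obtain ⟨a, b, rfl⟩ := List.length_eq_two.mp hlen
    change bivectorPairing (π + π') a b = bivectorPairing π a b + bivectorPairing π' a b
    rw [map_add, LinearMap.add_apply, LinearMap.add_apply]
  · exact ((hasBidegree_ofBivector _).1 l hlen).trans
      (((hasBidegree_ofBivector π).add (hasBidegree_ofBivector π')).1 l hlen).symm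

theorem ofBivector_sum {ι : Type*} (s : Finset ι) (π : ι → ⋀[R]^2 L) :
    ofBivector (∑ i ∈ s, π i) = ∑ i ∈ s, ofBivector (π i) :=
  map_sum (AddMonoidHom.mk' (ofBivector (R := R) (L := L)) ofBivector_add) π s

theorem ofBivector_cov_apply (π : ⋀[R]^2 L) (α : Module.Dual R L) (a : Forms R L) :
    ofBivector π [cov α, a] = -interior (sharp π α) a :=
  bivectorPairing_cov_left π α a

theorem bracket_ofEnd_ofForm (N : L →ₗ[R] L) (a : Forms R L) :
    ⁅ofEnd N, ofForm a⁆ = ofForm (endDer N a) :=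
  bracket_ofForm_of_hasMomentum_one (hasBidegree_ofEnd N).hasMomentum a

theorem bracket_ofBivector_ofForm (π : ⋀[R]^2 L) (ω₂ : ⋀[R]^2 (Module.Dual R L)) :
    ⁅ofBivector π, ofForm (ω₂ : Forms R L)⁆ = -ofEnd (sharp π ∘ₗ flat ω₂) := by
  have hω₂ : involution R L (ω₂ : Forms R L) = ω₂ := involution_eq_self_of_even ω₂.2 even_two
  have hflat (α : Module.Dual R L) : flat ω₂ (sharp π α) = α ∘ₗ (sharp π ∘ₗ flat ω₂) := by
    ext Y
    rw [LinearMap.comp_apply, LinearMap.comp_apply, dual_sharp, flat_skew]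
  have hbracket := (hasBidegree_ofBivector π).bracket (hasBidegree_ofForm ω₂.2) (ε'' := 1)
    (δ'' := 1) rfl rfl
  refine ext_of_hasBidegree_one hbracket (hasBidegree_ofEnd _).neg (fun f => ?_) fun α => ?_
  · rw [bracket_ofForm_apply, CotangentFunctions.neg_apply]
    exact (bivectorPairing_fn_right π f _).trans <|
      (neg_eq_zero.mpr (endDer_fn _ f)).symm
  · rw [bracket_ofForm_apply, CotangentFunctions.neg_apply]
    change bivectorPairing π ω₂ (cov α) = -endDer _ (cov α)
    rw [bivectorPairing_symm_even π _ _ hω₂, bivectorPairing_cov_left, interior_coe, endDer_cov,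
      hflat]

end Tensors

section Hamiltonian

variable {R : Type*} [CommRing R] [Algebra ℝ R] {L : Type*} [AddCommGroup L] [Module R L]

theorem HasBidegree.apply_singleton_mem {P : CotangentFunctions R L} (hP : HasBidegree P 1 2)
    {k : ℕ} {a : Forms R L} (ha : a ∈ ⋀[R]^k (Module.Dual R L)) :
    P [a] ∈ ⋀[R]^(k + 1) (Module.Dual R L) :=
  (hP.2 [a] [k] (.cons ha .nil)).1 (k + 1) (by rw [List.sum_singleton])

theorem CotangentFunctions.apply_neg_singleton (P : CotangentFunctions R L) (a : Forms R L) :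
    P [-a] = -P [a] :=
  congrFun (P.2.contr_neg a) []

variable [Module ℝ L] [IsScalarTower ℝ R L]

theorem hasSign_fn (f : R) : HasSign (involution R L) (fn f) 1 := by
  simpa only [zpow_zero] using hasSign_of_mem_formsDegree (fn_mem_formsDegree (L := L) f)

theorem hasSign_cov (α : Module.Dual R L) : HasSign (involution R L) (cov α) (-1) := by
  simpa only [zpow_one] using hasSign_of_mem_formsDegree (cov_mem_formsDegree α)

section Derivation

variable {P : CotangentFunctions R L} {b : Forms R L} {s u : ℝ}

theorem bracket_ofEnd_singleton (hP : HasParity (involution R L) P s) (hP₁ : HasMomentum P 1)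
    (N : L →ₗ[R] L) (hb : HasSign (involution R L) b u) :
    ⁅ofEnd N, P⁆ [b] = deformedDifferential P N b := by
  rw [bracket_singleton_of_hasMomentum_one (hasParity_ofEnd N) hP (hasBidegree_ofEnd N).hasMomentum
    hP₁ hb, koszulSign_one_left, one_smul]
  rfl

theorem bracket_ofBivector_cov (hP : HasParity (involution R L) P (-1)) (hP₁ : HasMomentum P 1)
    (π : ⋀[R]^2 L) (α : Module.Dual R L) (hb : HasSign (involution R L) b u) :
    ⁅ofBivector π, P⁆ [cov α, b]
      = bivectorPairing π (P [cov α]) b + lieDerivative P (sharp π α) b := by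
  have hπα : HasParity (involution R L) (⁅ofBivector π, ofForm (cov α)⁆ : CotangentFunctions R L)
      (-1) := (hasParity_ofBivector π).bracket_ofForm (hasSign_cov α)
  have lie : ⁅P, ⁅ofBivector π, ofForm (cov α)⁆⁆ [b] = -lieDerivative P (sharp π α) b := by
    rw [bracket_singleton_of_hasMomentum_one hP hπα hP₁
      ((hasBidegree_ofBivector π).hasMomentum.bracket_ofForm _) hb, koszulSign_neg_one_neg_one,
      bracket_ofForm_apply, bracket_ofForm_apply, ofBivector_cov_apply, ofBivector_cov_apply,
      CotangentFunctions.apply_neg_singleton, lieDerivative]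
    module
  rw [← bracket_ofForm_apply, bracket_even_bracket (hasParity_ofBivector π),
    bracket_ofForm_of_hasMomentum_one hP₁, sub_eq_add_neg, CotangentFunctions.add_apply,
    CotangentFunctions.neg_apply, lie, neg_neg, bracket_ofForm_apply]
  rfl

end Derivation

/-- The function `{π, μ}` on `T^*ΠA`. For the Hamiltonian `μ` of a Lie algebroid it corresponds to
the bracket `[·,·]_π` on `A^*`. -/
noncomputable def koszulFunction (μ : CotangentFunctions R L) (π : ⋀[R]^2 L) :
    CotangentFunctions R L :=
  ⁅ofBivector π, μ⁆

/-- The derivation `d_N^H` of `Ω(A)`, as the function `{N, μ} + {π, H}` on `T^*ΠA`. -/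
noncomputable def backgroundDerivation (μ : CotangentFunctions R L) (π : ⋀[R]^2 L)
    (N : L →ₗ[R] L) (H : Forms R L) : CotangentFunctions R L :=
  ⁅ofEnd N, μ⁆ + ⁅ofBivector π, ofForm H⁆

variable {μ : CotangentFunctions R L}

theorem HasBidegree.koszulFunction (hμ : HasBidegree μ 1 2) (π : ⋀[R]^2 L) :
    HasBidegree (koszulFunction μ π) 2 1 :=
  (hasBidegree_ofBivector π).bracket hμ rfl rfl

theorem HasBidegree.backgroundDerivation (hμ : HasBidegree μ 1 2) (π : ⋀[R]^2 L)
    (N : L →ₗ[R] L) {H : Forms R L} (hH : H ∈ ⋀[R]^3 (Module.Dual R L)) :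
    HasBidegree (backgroundDerivation μ π N H) 1 2 :=
  ((hasBidegree_ofEnd N).bracket hμ rfl rfl).add
    ((hasBidegree_ofBivector π).bracket (hasBidegree_ofForm hH) rfl rfl)

theorem koszulFunction_cov_cov (hμ : HasBidegree μ 1 2) (π : ⋀[R]^2 L) (α β : Module.Dual R L) :
    koszulFunction μ π [cov α, cov β] = koszulBracket μ π α β := by
  have hμα : involution R L (μ [cov α]) = μ [cov α] :=
    involution_eq_self_of_even (hμ.apply_singleton_mem (cov_mem_formsDegree α)) even_two
  have skew : fn (α (sharp π β)) = (-fn (β (sharp π α)) : Forms R L) := by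
    rw [dual_sharp π β α, fn, fn, map_neg]
  refine (bracket_ofBivector_cov (hμ.hasParity_of_odd (by decide)) hμ.hasMomentum π α
    (hasSign_cov β)).trans ?_
  rw [bivectorPairing_symm_even π _ _ hμα, bivectorPairing_cov_left, koszulBracket, lieDerivative,
    lieDerivative, interior_cov, interior_cov, skew, CotangentFunctions.apply_neg_singleton]
  abel

theorem isBackgroundDerivation_backgroundDerivation (hμ : HasBidegree μ 1 2) (π : ⋀[R]^2 L)
    (N : L →ₗ[R] L) {H : Forms R L} (hH : H ∈ ⋀[R]^3 (Module.Dual R L)) :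
    IsBackgroundDerivation μ π N H (backgroundDerivation μ π N H) := by
  have apply {b : Forms R L} {u : ℝ} (hb : HasSign (involution R L) b u) :
      backgroundDerivation μ π N H [b] = deformedDifferential μ N b + bivectorPairing π H b := by
    rw [backgroundDerivation, CotangentFunctions.add_apply, bracket_ofForm_apply,
      bracket_ofEnd_singleton (hμ.hasParity_of_odd (by decide)) hμ.hasMomentum N hb]
    rfl
  have hodd : involution R L H = -H := involution_eq_neg_of_odd hH (by decide)
  refine ⟨hμ.backgroundDerivation π N hH, fun f => ?_, fun α => ?_⟩
  · rw [apply (hasSign_fn f), bivectorPairing_fn_right, add_zero]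
  · rw [apply (hasSign_cov α), bivectorPairing_symm_odd π _ _ hodd (involution_cov α),
      bivectorPairing_cov_left, neg_neg]

theorem isBackgroundDerivation_iff (hμ : HasBidegree μ 1 2) (π : ⋀[R]^2 L) (N : L →ₗ[R] L)
    {H : Forms R L} (hH : H ∈ ⋀[R]^3 (Module.Dual R L)) {P : CotangentFunctions R L} :
    IsBackgroundDerivation μ π N H P ↔ P = backgroundDerivation μ π N H := by
  have hδ := isBackgroundDerivation_backgroundDerivation hμ π N hH
  refine ⟨fun hP => ?_, fun h => h ▸ hδ⟩
  exact ext_of_hasBidegree_one hP.bidegree hδ.bidegree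
    (fun f => (hP.apply_fn f).trans (hδ.apply_fn f).symm)
    (fun α => (hP.apply_cov α).trans (hδ.apply_cov α).symm)

namespace LieAlgebroid

variable {𝓐 : LieAlgebroid R L}

theorem IsHamiltonian.koszulFunction_cov_fn (hμ : 𝓐.IsHamiltonian μ) (π : ⋀[R]^2 L)
    (α : Module.Dual R L) (f : R) :
    koszulFunction μ π [cov α, fn f] = fn (𝓐.anchor (sharp π α) f) := by
  have hzero : μ [0] = 0 := congrFun μ.2.contr_zero []
  refine (bracket_ofBivector_cov (hμ.bidegree.hasParity_of_odd (by decide))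
    hμ.bidegree.hasMomentum π α (hasSign_fn f)).trans ?_
  rw [bivectorPairing_fn_right, lieDerivative, interior_fn, hzero, hμ.apply_fn, zero_add,
    add_zero]

theorem IsHamiltonian.isKoszulHamiltonian_koszulFunction (hμ : 𝓐.IsHamiltonian μ)
    (π : ⋀[R]^2 L) : IsKoszulHamiltonian 𝓐 μ π (koszulFunction μ π) :=
  ⟨hμ.bidegree.koszulFunction π, koszulFunction_cov_cov hμ.bidegree π,
    hμ.koszulFunction_cov_fn π⟩

theorem IsHamiltonian.isKoszulHamiltonian_iff (hμ : 𝓐.IsHamiltonian μ) (π : ⋀[R]^2 L)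
    {P : CotangentFunctions R L} :
    IsKoszulHamiltonian 𝓐 μ π P ↔ P = koszulFunction μ π := by
  have hK := hμ.isKoszulHamiltonian_koszulFunction π
  refine ⟨fun hP => ?_, fun h => h ▸ hK⟩
  exact ext_of_hasBidegree_two_one hP.bidegree hK.bidegree
    (fun α f => (hP.apply_cov_fn α f).trans (hK.apply_cov_fn α f).symm)
    (fun α β => (hP.apply_cov_cov α β).trans (hK.apply_cov_cov α β).symm)

end LieAlgebroid

end Hamiltonian

section Poisson

variable {R : Type*} [CommRing R] {L : Type*} [AddCommGroup L] [Module R L]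

/-- The value of a trivector on three one-forms. It is defined on the whole exterior algebra, since
that is where the Schouten-Nijenhuis bracket of two bivectors lives. -/
noncomputable def evalTrivector (α β γ : Module.Dual R L) : ExteriorAlgebra R L →ₗ[R] R :=
  (ExteriorAlgebra.algebraMapInv (R := R) (M := L)).toLinearMap ∘ₗ
    CliffordAlgebra.contractLeft (Q := (0 : QuadraticForm R L)) γ ∘ₗ
    CliffordAlgebra.contractLeft (Q := (0 : QuadraticForm R L)) β ∘ₗ
    CliffordAlgebra.contractLeft (Q := (0 : QuadraticForm R L)) α

theorem evalTrivector_ι_mul_ι_mul_ι (α β γ : Module.Dual R L) (X Y Z : L) :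
    evalTrivector α β γ (ExteriorAlgebra.ι R X * ExteriorAlgebra.ι R Y * ExteriorAlgebra.ι R Z)
      = α X * (β Y * γ Z - β Z * γ Y) - α Y * (β X * γ Z - β Z * γ X)
        + α Z * (β X * γ Y - β Y * γ X) := by
  have contract_ι_mul (δ : Module.Dual R L) (X : L) (b : ExteriorAlgebra R L) :
      CliffordAlgebra.contractLeft (Q := (0 : QuadraticForm R L)) δ (ExteriorAlgebra.ι R X * b)
        = δ X • b - ExteriorAlgebra.ι R X *
          CliffordAlgebra.contractLeft (Q := (0 : QuadraticForm R L)) δ b :=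
    CliffordAlgebra.contractLeft_ι_mul _ _ _
  have contract_ι (δ : Module.Dual R L) (X : L) :
      CliffordAlgebra.contractLeft (Q := (0 : QuadraticForm R L)) δ (ExteriorAlgebra.ι R X)
        = algebraMap R _ (δ X) :=
    CliffordAlgebra.contractLeft_ι _ _ _
  have contract_algebraMap (δ : Module.Dual R L) (r : R) :
      CliffordAlgebra.contractLeft (Q := (0 : QuadraticForm R L)) δ
        (algebraMap R (ExteriorAlgebra R L) r) = 0 :=
    CliffordAlgebra.contractLeft_algebraMap _ _ _
  have algebraMapInv (r : R) :
      ExteriorAlgebra.algebraMapInv (algebraMap R (ExteriorAlgebra R L) r) = r :=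
    ExteriorAlgebra.algebraMap_leftInverse L r
  simp only [evalTrivector, LinearMap.comp_apply, mul_assoc, contract_ι_mul, contract_ι, map_sub,
    map_smul, contract_algebraMap, mul_zero, smul_zero, sub_zero, AlgHom.toLinearMap_apply,
    algebraMapInv, smul_eq_mul]
  ring

variable [Algebra ℝ R] [Module ℝ L]

namespace LieAlgebroid

theorem bracket_swap (𝓐 : LieAlgebroid R L) (X Y : L) : 𝓐.bracket X Y = -𝓐.bracket Y X := by
  have h := 𝓐.bracket_self (X + Y)
  rw [map_add, map_add, LinearMap.add_apply, LinearMap.add_apply, 𝓐.bracket_self,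
    𝓐.bracket_self, zero_add, add_zero] at h
  exact eq_neg_of_add_eq_zero_right h

theorem bracket_smul_left (𝓐 : LieAlgebroid R L) (f : R) (X Y : L) :
    𝓐.bracket (f • X) Y = f • 𝓐.bracket X Y - 𝓐.anchor Y f • X := by
  rw [𝓐.bracket_swap, 𝓐.leibniz, 𝓐.bracket_swap Y X]
  module

variable [IsScalarTower ℝ R L] {μ : CotangentFunctions R L} {𝓐 : LieAlgebroid R L}

theorem IsHamiltonian.interior_koszulBracket (hμ : 𝓐.IsHamiltonian μ) (π : ⋀[R]^2 L)
    (α β : Module.Dual R L) (Z : L) :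
    interior Z (koszulBracket μ π α β) =
      fn (𝓐.anchor (sharp π α) (β Z) - β (𝓐.bracket (sharp π α) Z)
        - 𝓐.anchor (sharp π β) (α Z) + α (𝓐.bracket (sharp π β) Z)
        - 𝓐.anchor Z (β (sharp π α))) := by
  simp only [koszulBracket, lieDerivative, interior_cov, map_add, map_sub, hμ.apply_cov,
    hμ.apply_fn, fn]
  rw [dual_sharp π β α, map_neg, map_neg]
  abel

theorem IsHamiltonian.koszulFunction_bracket_ofBivector (hμ : 𝓐.IsHamiltonian μ)
    (π τ : ⋀[R]^2 L) (α β γ : Module.Dual R L) :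
    ⁅koszulFunction μ π, ofBivector τ⁆ [cov α, cov β, cov γ] =
      -(fn (𝓐.anchor (sharp π α) (γ (sharp τ β)) - 𝓐.anchor (sharp π β) (γ (sharp τ α))
          + 𝓐.anchor (sharp π γ) (β (sharp τ α)))
        + interior (sharp τ α) (koszulBracket μ π β γ)
        - interior (sharp τ β) (koszulBracket μ π α γ)
        + interior (sharp τ γ) (koszulBracket μ π α β)) := by
  have hK := hμ.bidegree.koszulFunction π
  have pairing (α β : Module.Dual R L) :
      ofBivector τ [cov α, cov β] = (fn (-(β (sharp τ α))) : Forms R L) := by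
    rw [ofBivector_cov_apply, interior_cov, fn, fn, map_neg]
  rw [bracket_triple_of_hasMomentum_two (hK.hasParity_of_odd (by decide)) (hasParity_ofBivector τ)
    hK.hasMomentum (hasBidegree_ofBivector τ).hasMomentum (hasSign_cov α) (hasSign_cov β)
    (hasSign_cov γ)]
  simp only [koszulFunction_cov_cov hμ.bidegree, ofBivector_cov_apply τ _ (koszulBracket _ _ _ _),
    pairing, hμ.koszulFunction_cov_fn]
  simp only [fn, map_neg, map_add, map_sub]
  abel

theorem IsHamiltonian.koszulFunction_wedge_bracket (hμ : 𝓐.IsHamiltonian μ) (X Y X' Y' : L)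
    (α β γ : Module.Dual R L) :
    ⁅koszulFunction μ (wedge X Y), ofBivector (wedge X' Y')⁆ [cov α, cov β, cov γ]
      = fn (-evalTrivector α β γ (𝓐.schoutenWedge X Y X' Y')) := by
  rw [hμ.koszulFunction_bracket_ofBivector]
  simp only [hμ.interior_koszulBracket, fn, ← map_add, ← map_sub, ← map_neg]
  congr 1
  simp only [schoutenWedge, map_add, map_sub, map_neg, evalTrivector_ι_mul_ι_mul_ι, sharp_wedge,
    map_smul, LinearMap.sub_apply, 𝓐.leibniz, 𝓐.bracket_smul_left, Derivation.coe_sub,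
    Derivation.coe_smul, Pi.sub_apply, Pi.smul_apply, Derivation.leibniz, smul_eq_mul]
  ring

theorem IsHamiltonian.koszulFunction_bracket_of_isPoisson (hμ : 𝓐.IsHamiltonian μ)
    {π : ⋀[R]^2 L} (hπ : 𝓐.IsPoisson π) : ⁅koszulFunction μ π, ofBivector π⁆ = 0 := by
  refine eq_zero_of_hasBidegree_three_zero
    ((hμ.bidegree.koszulFunction π).bracket (hasBidegree_ofBivector π) rfl rfl) fun α β γ => ?_
  obtain ⟨n, X, Y, rfl, hschouten⟩ := hπ
  have expand : ⁅koszulFunction μ (∑ j, wedge (X j) (Y j) : ⋀[R]^2 L),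
        ofBivector (∑ i, wedge (X i) (Y i) : ⋀[R]^2 L)⁆
      = ∑ i, ∑ j, ⁅koszulFunction μ (wedge (X i) (Y i) : ⋀[R]^2 L),
          ofBivector (wedge (X j) (Y j) : ⋀[R]^2 L)⁆ := by
    simp only [koszulFunction, ofBivector_sum, sum_bracket, bracket_sum]
    exact Finset.sum_comm
  rw [expand]
  simp only [Submodule.coe_sum, Finset.sum_apply, hμ.koszulFunction_wedge_bracket, fn, map_neg,
    Finset.sum_neg_distrib, ← map_sum, hschouten, map_zero, neg_zero]

end LieAlgebroid

variable [IsScalarTower ℝ R L] {μ : CotangentFunctions R L}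

theorem bracket_koszulFunction_self (hμ : HasParity (involution R L) μ (-1)) (hμμ : ⁅μ, μ⁆ = 0)
    {π : ⋀[R]^2 L} (hπ : ⁅koszulFunction μ π, ofBivector π⁆ = 0) :
    ⁅koszulFunction μ π, koszulFunction μ π⁆ = 0 := by
  have hπ_even := hasParity_ofBivector π
  have hK : HasParity (involution R L) (koszulFunction μ π) (-1) := by
    simpa only [koszulFunction, one_mul] using hπ_even.bracket hμ
  have hμπ : ⁅μ, ofBivector π⁆ = -koszulFunction μ π := bracket_swap_even μ hπ_even
  have hKμ : ⁅koszulFunction μ π, μ⁆ = 0 := by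
    have h := bracket_bracket_even μ μ hπ_even
    rw [hμμ, bracket_zero_left, hμπ, bracket_neg_left, bracket_neg_right,
      bracket_swap_odd hμ hK] at h
    have half : ⁅koszulFunction μ π, μ⁆ =
        (-2⁻¹ : ℝ) • (-⁅koszulFunction μ π, μ⁆ + -⁅koszulFunction μ π, μ⁆) := by module
    rw [half, ← h, smul_zero]
  have h := bracket_bracket_even (koszulFunction μ π) μ hπ_even
  rw [hKμ, bracket_zero_left, hμπ, hπ, bracket_zero_left, bracket_neg_right, add_zero] at h
  exact neg_eq_zero.mp h.symm

end Poisson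

section Twist

open Finset.HasAntidiagonal (antidiagonal mem_antidiagonal)

variable {R : Type*} [CommRing R] [Algebra ℝ R] {L : Type*} [AddCommGroup L] [Module R L]
  [Module ℝ L] [IsScalarTower ℝ R L] {P Q T τ : CotangentFunctions R L}

/-- The `k`-th term `(1/k!) {…{{P, τ}, τ}, …, τ}` of the series defining `e^τ P`. -/
noncomputable def twistTerm (τ P : CotangentFunctions R L) (k : ℕ) : CotangentFunctions R L :=
  ((k.factorial : ℝ)⁻¹) • (fun Q : CotangentFunctions R L => ⁅Q, τ⁆)^[k] P

theorem twistTerm_zero (τ P : CotangentFunctions R L) : twistTerm τ P 0 = P := by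
  simp only [twistTerm, Nat.factorial_zero, Nat.cast_one, inv_one, one_smul,
    Function.iterate_zero_apply]

theorem twistTerm_succ (τ P : CotangentFunctions R L) (k : ℕ) :
    twistTerm τ P (k + 1) = ((k + 1 : ℕ) : ℝ)⁻¹ • ⁅twistTerm τ P k, τ⁆ := by
  rw [twistTerm, twistTerm, bracket_smul_left, smul_smul, Function.iterate_succ_apply',
    Nat.factorial_succ, Nat.cast_mul, mul_inv]

theorem twistTerm_bracket_right (τ P : CotangentFunctions R L) (k : ℕ) :
    ⁅twistTerm τ P k, τ⁆ = ((k + 1 : ℕ) : ℝ) • twistTerm τ P (k + 1) := by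
  rw [twistTerm_succ, smul_inv_smul₀ (Nat.cast_ne_zero.mpr k.succ_ne_zero)]

theorem twistTerm_eq_zero {n k : ℕ} (h : twistTerm τ P n = 0) (hk : n ≤ k) :
    twistTerm τ P k = 0 := by
  induction k, hk using Nat.le_induction with
  | base => exact h
  | succ k _ ih => rw [twistTerm_succ, ih, bracket_zero_left, smul_zero]

theorem twistTerminates_iff : TwistTerminates τ P ↔ ∃ n, twistTerm τ P n = 0 := by
  have iterate_eq_zero_iff (k : ℕ) :
      (fun Q : CotangentFunctions R L => ⁅Q, τ⁆)^[k] P = 0 ↔ twistTerm τ P k = 0 :=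
    (smul_eq_zero_iff_right (inv_ne_zero (Nat.cast_ne_zero.mpr k.factorial_ne_zero))).symm
  simp only [TwistTerminates, iterate_eq_zero_iff]
  exact ⟨fun ⟨n, h⟩ => ⟨n, h n le_rfl⟩, fun ⟨n, h⟩ => ⟨n, fun _ => twistTerm_eq_zero h⟩⟩

theorem twist_eq_sum {n : ℕ} (h : twistTerm τ P n = 0) :
    twist τ P = ∑ k ∈ Finset.range n, twistTerm τ P k := by
  refine finsum_eq_sum_of_support_subset _ fun k hk => Finset.mem_coe.mpr ?_
  by_contra hkn
  exact hk (twistTerm_eq_zero h (not_lt.mp (Finset.mem_range.not.mp hkn)))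

theorem twist_zero (τ : CotangentFunctions R L) : twist τ 0 = 0 :=
  twist_eq_sum (twistTerm_zero τ 0)

theorem twistTerminates_and_twist_eq_add (hP : ⁅P, τ⁆ = Q) (hQ : ⁅Q, τ⁆ = 0) :
    TwistTerminates τ P ∧ twist τ P = P + Q := by
  have one : twistTerm τ P 1 = Q := by
    rw [twistTerm_succ, twistTerm_zero, hP, zero_add, Nat.cast_one, inv_one, one_smul]
  have two : twistTerm τ P 2 = 0 := by rw [twistTerm_succ, one, hQ, smul_zero]
  refine ⟨twistTerminates_iff.mpr ⟨2, two⟩, ?_⟩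
  rw [twist_eq_sum two, Finset.sum_range_succ, Finset.sum_range_one, twistTerm_zero, one]

theorem twistTerminates_and_twist_eq_add_add (hP : ⁅P, τ⁆ = Q) (hQ : ⁅Q, τ⁆ = (2 : ℝ) • T)
    (hT : ⁅T, τ⁆ = 0) : TwistTerminates τ P ∧ twist τ P = P + Q + T := by
  have one : twistTerm τ P 1 = Q := by
    rw [twistTerm_succ, twistTerm_zero, hP, zero_add, Nat.cast_one, inv_one, one_smul]
  have two : twistTerm τ P 2 = T := by
    rw [twistTerm_succ, one, hQ, smul_smul]
    norm_num
  have three : twistTerm τ P 3 = 0 := by rw [twistTerm_succ, two, hT, smul_zero]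
  refine ⟨twistTerminates_iff.mpr ⟨3, three⟩, ?_⟩
  rw [twist_eq_sum three, Finset.sum_range_succ, Finset.sum_range_succ, Finset.sum_range_one,
    twistTerm_zero, one, two]

theorem twistTerm_bracket (hτ : HasParity (involution R L) τ 1) (P Q : CotangentFunctions R L)
    (n : ℕ) :
    twistTerm τ ⁅P, Q⁆ n =
      ∑ ij ∈ antidiagonal n, ⁅twistTerm τ P ij.1, twistTerm τ Q ij.2⁆ := by
  induction n with
  | zero => simp only [Finset.Nat.antidiagonal_zero, Finset.sum_singleton, twistTerm_zero]
  | succ n ih =>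
    let f (i j : ℕ) : CotangentFunctions R L := ⁅twistTerm τ P i, twistTerm τ Q j⁆
    have leibniz (i j : ℕ) :
        ⁅f i j, τ⁆ = ((j + 1 : ℕ) : ℝ) • f i (j + 1) + ((i + 1 : ℕ) : ℝ) • f (i + 1) j := by
      simp only [f, bracket_bracket_even _ _ hτ, twistTerm_bracket_right, bracket_smul_left,
        bracket_smul_right]
    have weighted : ((n + 1 : ℕ) : ℝ) • ∑ ij ∈ antidiagonal (n + 1), f ij.1 ij.2
        = ∑ ij ∈ antidiagonal n, ⁅f ij.1 ij.2, τ⁆ := by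
      calc ((n + 1 : ℕ) : ℝ) • ∑ ij ∈ antidiagonal (n + 1), f ij.1 ij.2
          = ∑ ij ∈ antidiagonal (n + 1),
              ((ij.2 : ℝ) • f ij.1 ij.2 + (ij.1 : ℝ) • f ij.1 ij.2) := by
            rw [Finset.smul_sum]
            refine Finset.sum_congr rfl fun ij hij => ?_
            rw [← mem_antidiagonal.mp hij, ← add_smul, Nat.cast_add, add_comm (ij.1 : ℝ)]
        _ = ∑ ij ∈ antidiagonal n, ⁅f ij.1 ij.2, τ⁆ := by
            rw [Finset.sum_add_distrib, Finset.Nat.sum_antidiagonal_succ',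
              Finset.Nat.sum_antidiagonal_succ (f := fun ij => (ij.1 : ℝ) • f ij.1 ij.2)]
            simp only [leibniz, Finset.sum_add_distrib, Nat.cast_zero, zero_smul, zero_add]
    rw [twistTerm_succ, ih, sum_bracket, ← weighted,
      inv_smul_smul₀ (Nat.cast_ne_zero.mpr n.succ_ne_zero)]

theorem twist_bracket (hτ : HasParity (involution R L) τ 1) (hP : TwistTerminates τ P)
    (hQ : TwistTerminates τ Q) : twist τ ⁅P, Q⁆ = ⁅twist τ P, twist τ Q⁆ := by
  obtain ⟨m, hm⟩ := twistTerminates_iff.mp hP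
  obtain ⟨n, hn⟩ := twistTerminates_iff.mp hQ
  let f (ij : ℕ × ℕ) : CotangentFunctions R L := ⁅twistTerm τ P ij.1, twistTerm τ Q ij.2⁆
  have f_eq_zero {ij : ℕ × ℕ} (h : ij ∉ Finset.range m ×ˢ Finset.range n) : f ij = 0 := by
    rw [Finset.mem_product, Finset.mem_range, Finset.mem_range, not_and_or, not_lt, not_lt] at h
    rcases h with h | h
    · simp only [f, twistTerm_eq_zero hm h, bracket_zero_left]
    · simp only [f, twistTerm_eq_zero hn h, bracket_zero_right]
  have last : twistTerm τ ⁅P, Q⁆ (m + n) = 0 := by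
    rw [twistTerm_bracket hτ]
    refine Finset.sum_eq_zero fun ij hij => f_eq_zero fun h => ?_
    simp only [mem_antidiagonal, Finset.mem_product, Finset.mem_range] at hij h
    omega
  rw [twist_eq_sum last, twist_eq_sum hm, twist_eq_sum hn, sum_bracket]
  simp only [bracket_sum, twistTerm_bracket hτ]
  rw [← Finset.sum_product', ← Finset.sum_fiberwise_of_maps_to (t := Finset.range (m + n))
    (g := fun ij : ℕ × ℕ => ij.1 + ij.2)]
  · refine Finset.sum_congr rfl fun k _ => (Finset.sum_subset ?_ ?_).symm
    · intro ij hij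
      exact mem_antidiagonal.mpr (Finset.mem_filter.mp hij).2
    · intro ij hij h
      exact f_eq_zero fun h' => h (Finset.mem_filter.mpr ⟨h', mem_antidiagonal.mp hij⟩)
  · intro ij h
    simp only [Finset.mem_product, Finset.mem_range] at h ⊢
    omega

theorem bracket_twist_self (hτ : HasParity (involution R L) τ 1) (hP : TwistTerminates τ P)
    (hPP : ⁅P, P⁆ = 0) : ⁅twist τ P, twist τ P⁆ = 0 := by
  rw [← twist_bracket hτ hP hP, hPP, twist_zero]

end Twist

section TwoForm

variable {R : Type*} [CommRing R] [Algebra ℝ R] {L : Type*} [AddCommGroup L] [Module R L]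
  [Module ℝ L] [IsScalarTower ℝ R L] {μ : CotangentFunctions R L}

theorem inducedStructure_eq (μ : CotangentFunctions R L) (π : ⋀[R]^2 L) (N : L →ₗ[R] L)
    (ψ H : Forms R L) :
    inducedStructure μ π N ψ H =
      koszulFunction μ π + backgroundDerivation μ π N H + ofForm (ψ + endDer N H) := by
  rw [inducedStructure, koszulFunction, backgroundDerivation, bracket_add_left, bracket_add_right,
    bracket_add_right, bracket_ofEnd_ofForm, ofForm_add]
  abel

theorem HasBidegree.koszulFunction_bracket_ofForm (hμ : HasBidegree μ 1 2) (π : ⋀[R]^2 L)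
    (ω₂ : ⋀[R]^2 (Module.Dual R L)) :
    ⁅SuperCotangent.koszulFunction μ π, ofForm (ω₂ : Forms R L)⁆ =
      -SuperCotangent.backgroundDerivation μ π (sharp π ∘ₗ flat ω₂) (-μ [(ω₂ : Forms R L)]) := by
  have hω₂ := (hasBidegree_ofForm ω₂.2).hasParity_of_even even_two
  rw [SuperCotangent.koszulFunction, SuperCotangent.backgroundDerivation,
    bracket_bracket_even _ _ hω₂, bracket_ofForm_of_hasMomentum_one hμ.hasMomentum,
    bracket_ofBivector_ofForm, ofForm_neg, bracket_neg_right, bracket_neg_left]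
  abel

theorem HasBidegree.backgroundDerivation_bracket_ofForm (hμ : HasBidegree μ 1 2) (π : ⋀[R]^2 L)
    (ω₂ : ⋀[R]^2 (Module.Dual R L)) :
    ⁅SuperCotangent.backgroundDerivation μ π (sharp π ∘ₗ flat ω₂) (-μ [(ω₂ : Forms R L)]),
        ofForm (ω₂ : Forms R L)⁆ =
      (-2 : ℝ) • ofForm (μ [omegaN ω₂ (sharp π ∘ₗ flat ω₂)]
        + endDer (sharp π ∘ₗ flat ω₂) (-μ [(ω₂ : Forms R L)])) := by
  have hω₂ := (hasBidegree_ofForm ω₂.2).hasParity_of_even even_two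
  have hN := (hasBidegree_ofEnd (sharp π ∘ₗ flat ω₂)).bracket hμ (ε'' := 1) (δ'' := 2) rfl rfl
  have deformed : ⁅⁅ofEnd (sharp π ∘ₗ flat ω₂), μ⁆, ofForm (ω₂ : Forms R L)⁆ =
      ofForm (deformedDifferential μ (sharp π ∘ₗ flat ω₂) ω₂) := by
    rw [bracket_ofForm_of_hasMomentum_one hN.hasMomentum,
      bracket_ofEnd_singleton (hμ.hasParity_of_odd (by decide)) hμ.hasMomentum _
        (hasSign_of_mem_formsDegree (mem_formsDegree_natCast.mpr ω₂.2))]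
  have background : ⁅⁅ofBivector π, ofForm (-μ [(ω₂ : Forms R L)])⁆, ofForm (ω₂ : Forms R L)⁆ =
      -ofForm (endDer (sharp π ∘ₗ flat ω₂) (-μ [(ω₂ : Forms R L)])) := by
    rw [bracket_bracket_even _ _ hω₂, bracket_ofForm_ofForm, bracket_zero_right, zero_add,
      bracket_ofBivector_ofForm, bracket_neg_left, bracket_ofEnd_ofForm]
  have half : μ [omegaN ω₂ (sharp π ∘ₗ flat ω₂)] =
      (2⁻¹ : ℝ) • μ [endDer (sharp π ∘ₗ flat ω₂) (ω₂ : Forms R L)] :=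
    μ.2.map_smul [] [] _ _
  rw [SuperCotangent.backgroundDerivation, bracket_add_left, deformed, background, half,
    ← ofForm_neg, ← ofForm_add, ← ofForm_smul, deformedDifferential]
  congr 1
  rw [map_neg]
  module

theorem HasBidegree.twistTerminates_and_twist_neg_ofForm (hμ : HasBidegree μ 1 2) (π : ⋀[R]^2 L)
    (ω₂ : ⋀[R]^2 (Module.Dual R L)) :
    TwistTerminates (-ofForm (ω₂ : Forms R L)) (SuperCotangent.koszulFunction μ π) ∧
      twist (-ofForm (ω₂ : Forms R L)) (SuperCotangent.koszulFunction μ π) =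
        inducedStructure μ π (sharp π ∘ₗ flat ω₂) (μ [omegaN ω₂ (sharp π ∘ₗ flat ω₂)])
          (-μ [(ω₂ : Forms R L)]) := by
  rw [inducedStructure_eq]
  refine twistTerminates_and_twist_eq_add_add ?_ ?_ ?_
  · rw [bracket_neg_right, hμ.koszulFunction_bracket_ofForm, neg_neg]
  · rw [bracket_neg_right, hμ.backgroundDerivation_bracket_ofForm]
    module
  · rw [bracket_neg_right, bracket_ofForm_ofForm, neg_zero]

theorem LieAlgebroid.IsHamiltonian.twistTerminates_and_twist_neg_ofBivector {𝓐 : LieAlgebroid R L}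
    (hμ : 𝓐.IsHamiltonian μ) {π : ⋀[R]^2 L} (hπ : 𝓐.IsPoisson π) :
    TwistTerminates (-ofBivector π) μ ∧ twist (-ofBivector π) μ = μ + koszulFunction μ π := by
  refine twistTerminates_and_twist_eq_add ?_ ?_
  · rw [bracket_neg_right, bracket_swap_even μ (hasParity_ofBivector π), neg_neg, koszulFunction]
  · rw [bracket_neg_right, hμ.koszulFunction_bracket_of_isPoisson hπ, neg_zero]

end TwoForm

end SuperCotangent

theorem mainTheorem6_general {R : Type*} [CommRing R] [Algebra ℝ R] {L : Type*} [AddCommGroup L]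
    [Module R L] [Module ℝ L] [IsScalarTower ℝ R L] (𝓐 : LieAlgebroid R L)
    (μ : CotangentFunctions R L) (hμ : 𝓐.IsHamiltonian μ) (π : ⋀[R]^2 L) (hπ : 𝓐.IsPoisson π)
    (ω₂ : ⋀[R]^2 (Module.Dual R L)) :
    let N := sharp π ∘ₗ flat ω₂
    let ψ := μ [omegaN ω₂ N]
    let H := -μ [(ω₂ : Forms R L)]
    let S := inducedStructure μ π N ψ H
    let πf := ofBivector π
    let ωf := ofForm (ω₂ : Forms R L)
    ∃ μπ δ : CotangentFunctions R L,
      (∀ P, IsKoszulHamiltonian 𝓐 μ π P ↔ P = μπ) ∧ ⁅μπ, μπ⁆ = 0 ∧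
      (∀ P, IsBackgroundDerivation μ π N H P ↔ P = δ) ∧
      S = μπ + δ + ofForm (ψ + endDer N H) ∧ ⁅S, S⁆ = 0 ∧
      TwistTerminates (-πf) μ ∧ TwistTerminates (-ωf) (twist (-πf) μ - μ) ∧
      S = twist (-ωf) (twist (-πf) μ - μ) ∧
      twist (-πf) μ - μ = μπ ∧ S = twist (-ωf) μπ := by
  intro N ψ H S πf ωf
  have hH : H ∈ ⋀[R]^3 (Module.Dual R L) := neg_mem (hμ.bidegree.apply_singleton_mem ω₂.2)
  have hωf : HasParity (involution R L) (-ωf) 1 :=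
    (hasBidegree_ofForm ω₂.2).neg.hasParity_of_even even_two
  have master : ⁅koszulFunction μ π, koszulFunction μ π⁆ = 0 :=
    bracket_koszulFunction_self (hμ.bidegree.hasParity_of_odd (by decide)) hμ.bracket_self_eq_zero
      (hμ.koszulFunction_bracket_of_isPoisson hπ)
  obtain ⟨terminates_π, twist_π⟩ := hμ.twistTerminates_and_twist_neg_ofBivector hπ
  obtain ⟨terminates_ω, twist_ω⟩ := hμ.bidegree.twistTerminates_and_twist_neg_ofForm π ω₂
  have twist_π_sub : twist (-πf) μ - μ = koszulFunction μ π := by rw [twist_π, add_sub_cancel_left]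
  have S_self : ⁅S, S⁆ = 0 := by
    rw [show S = _ from twist_ω.symm]
    exact bracket_twist_self hωf terminates_ω master
  rw [twist_π_sub]
  exact ⟨koszulFunction μ π, backgroundDerivation μ π N H, fun _ => hμ.isKoszulHamiltonian_iff π,
    master,
    fun _ => isBackgroundDerivation_iff hμ.bidegree π N hH, inducedStructure_eq μ π N ψ H, S_self,
    terminates_π, terminates_ω, twist_ω.symm, rfl, twist_ω.symm⟩

theorem mainTheorem6 {n : ℕ} {M : Type*} [TopologicalSpace M] [T2Space M] [SigmaCompactSpace M]
    [ChartedSpace (EuclideanSpace ℝ (Fin n)) M] [IsManifold (𝓡 n) ∞ M]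
    {F : Type*} [NormedAddCommGroup F] [NormedSpace ℝ F] [FiniteDimensional ℝ F]
    {A : M → Type*} [TopologicalSpace (Bundle.TotalSpace F A)] [∀ x, TopologicalSpace (A x)]
    [FiberBundle F A] [∀ x, AddCommGroup (A x)] [∀ x, Module ℝ (A x)] [VectorBundle ℝ F A]
    [ContMDiffVectorBundle ∞ F A (𝓡 n)]
    -- a Lie algebroid structure on `A`, and the function `μ` on `T^*ΠA` that corresponds to it
    (𝓐 : LieAlgebroid C^∞⟮𝓡 n, M; ℝ⟯ Cₛ^∞⟮𝓡 n; F, A⟯)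
    (μ : CotangentFunctions C^∞⟮𝓡 n, M; ℝ⟯ Cₛ^∞⟮𝓡 n; F, A⟯) (hμ : 𝓐.IsHamiltonian μ)
    -- a Poisson bivector and a two-form
    (π : ⋀[C^∞⟮𝓡 n, M; ℝ⟯]^2 Cₛ^∞⟮𝓡 n; F, A⟯) (hπ : 𝓐.IsPoisson π)
    (ω₂ : ⋀[C^∞⟮𝓡 n, M; ℝ⟯]^2 (Module.Dual C^∞⟮𝓡 n, M; ℝ⟯ Cₛ^∞⟮𝓡 n; F, A⟯)) :
    let N := sharp π ∘ₗ flat ω₂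
    let ψ := μ [omegaN ω₂ N]
    let H := -μ [(ω₂ : Forms C^∞⟮𝓡 n, M; ℝ⟯ Cₛ^∞⟮𝓡 n; F, A⟯)]
    let S := inducedStructure μ π N ψ H
    let πf := ofBivector π
    let ωf := ofForm (ω₂ : Forms C^∞⟮𝓡 n, M; ℝ⟯ Cₛ^∞⟮𝓡 n; F, A⟯)
    ∃ μπ δ : CotangentFunctions C^∞⟮𝓡 n, M; ℝ⟯ Cₛ^∞⟮𝓡 n; F, A⟯,
      -- `μπ` is the Lie algebroid structure on `A^*` defined by `π`
      (∀ P, IsKoszulHamiltonian 𝓐 μ π P ↔ P = μπ) ∧ ⁅μπ, μπ⁆ = 0 ∧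
      -- `S` is the Lie quasi-bialgebroid structure given by `μπ`, the derivation `δ = d_N^H`
      -- and the three-form `ψ + i_N H`
      (∀ P, IsBackgroundDerivation μ π N H P ↔ P = δ) ∧
      S = μπ + δ + ofForm (ψ + endDer N H) ∧ ⁅S, S⁆ = 0 ∧
      -- the exponential series below are finite sums
      TwistTerminates (-πf) μ ∧ TwistTerminates (-ωf) (twist (-πf) μ - μ) ∧
      S = twist (-ωf) (twist (-πf) μ - μ) ∧
      twist (-πf) μ - μ = μπ ∧ S = twist (-ωf) μπ :=
  mainTheorem6_general 𝓐 μ hμ π hπ ω₂
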